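/- **Setting.** Let $L\in\mathbb R^{N\times M}$ ($N\ge 1$) be a loss matrix with rows $\ell_1,\dots,\ell_N$, let $\Sigma$ be a finite alphabet, and for every $i\in[N]$, $j\in[M]$ let $H_{i,j}$ be a probability distribution on $\Sigma$. In round $t$ the opponent chooses $j_t\in[M]$, the player chooses $I_t\in[N]$, incurs the (unobserved) loss $L_{I_t,j_t}$ and observes only a random signal drawn from $H_{I_t,j_t}$. The opponent is non-stochastic: $j_t$ may depend in an arbitrary, possibly randomized way on the complete past, and is chosen without knowledge of the player's randomness and of the signal in round $t$. Let $C_i=\{q\in\Delta_M:\ \ell_i\cdot q\le \ell_j\cdot q\ \text{for all } j\}$. Assume that the game is non-degenerate: every action $i$ is the unique best response to some $q\in\Delta_M$. Actions $i\neq j$ are neighbors if $C_i\cap C_j$ is non-empty of dimension $M-2$; every action is its own neighbor; $N_i$ is the set of neighbors of $i$. Let $\Xi_i$ be the matrix $\Xi_i(\sigma,j)=H_{i,j}(\sigma)$, and let $\Xi_{(i,j)}$ be $\Xi_i$ stacked on top of $\Xi_j$. Assume local observability: $\ell_i-\ell_j\in\operatorname{Im}\Xi_{(i,j)}^{\mathsf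 T}$ for all neighboring $i,j$. **Algorithm (Neighborhood Watch).** Fix vectors $v_{(i,j)}\in\mathbb R^{\Sigma\sqcup\Sigma}$ with $\ell_j-\ell_i=\Xi_{(i,j)}^{\mathsf T}v_{(i,j)}$ for all neighboring $i,j$, and parameters $\eta\ge 0$, $\gamma\in[0,1]$. To every $i$ belongs a local algorithm $\mathcal A_i$ with a distribution $q_i^t$ supported on $N_i$, initially uniform on $N_i$. In round $t$, find a distribution $p^t$ with $p^t=Q^tp^t$, where $Q^t=[q_1^t,\dots,q_N^t]$; draw $k_t\sim p^t$; play $I_t\sim q^t_{k_t}$; and receive the signal, written as a unit vector $u_t\in\mathbb R^{\Sigma}$. For $j\in N_i$ put $$b^t_{(i,j)}=v_{(i,j)}^{\mathsf T}\begin{bmatrix}\mathbf 1\{I_t=i\}\,u_t\\ \mathbf 1\{k_t=i\}\mathbf 1\{I_t=j\}\,u_t/q_i^t(j)\end{bmatrix}.$$ Then $\mathcal A_{k_t}$ is run: with $i=k_t$, it passes to an exponential weights algorithm on $N_i$ with learning rate $\eta$ the cost vector whose $j$-th entry, $j\in N_i$, is the sum of $b^r_{(i,j)}$ over all rounds $r\le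 t$ after the previous run of $\mathcal A_i$. If $x$ is the distribution returned by exponential weights, then $q_i^{t+1}=(1-\gamma)x+\frac{\gamma}{|N_i|}\mathbf 1_{N_i}$. For $i\ne k_t$, $q_i^{t+1}=q_i^t$. **Theorem.** Under these assumptions the algorithm can be run (vectors $v_{(i,j)}$ as above exist, and distributions $p^t=Q^tp^t$ always exist) and attains $O(\sqrt T)$ internal and external regret. Precisely: for every choice of vectors $v_{(i,j)}$ as above, with $\bar v=\max\|v_{(i,j)}\|_\infty$ over neighboring pairs, there is $\kappa_0$ such that for every $\kappa\ge\kappa_0$ there is a constant $C$ (depending only on $L,H,v,\kappa$) with the following property. For every $T\ge 1$, the algorithm run with $$\eta=\sqrt{\frac{\log N}{24\,\bar v^2\,T}},\qquad \gamma=\min\Big\{\frac12,\frac{\kappa}{\sqrt T}\Big\}$$ ($\eta=0$ if $N=1$) and with any choice of the fixed points $p^t$ satisfies, against every opponent, $$\sup_{\phi}\ \mathbb E\sum_{t=1}^T\big(L_{I_t,j_t}-L_{\phi(I_t),j_t}\big)\ \le\ C\sqrt T,$$ where the supremum is over all internal departure functions $\phi_{i\to j}$ ($\phi_{i\to j}(i)=j$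 and $\phi_{i\to j}(h)=h$ for $h\ne i$); and the same bound holds when the supremum is over all constant functions $\phi$ (external regret). -/

import Mathlib

noncomputable section

namespace PartialMonitoring

/-! ### The game: cells, neighbours, signal matrices -/

/-- `C_i`: the mixed strategies of the opponent against which `i` is a best response. -/
def cell {N M : ℕ} (L : Matrix (Fin N) (Fin M) ℝ) (i : Fin N) : Set (Fin M → ℝ) :=
  {q | q ∈ stdSimplex ℝ (Fin M) ∧ ∀ j, L i ⬝ᵥ q ≤ L j ⬝ᵥ q}

/-- The cells genuinely partition the simplex (up to common boundaries): every action is the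
unique best response to some mixed strategy of the opponent. -/
def Nondegenerate {N M : ℕ} (L : Matrix (Fin N) (Fin M) ℝ) : Prop :=
  ∀ i, ∃ q ∈ stdSimplex ℝ (Fin M), ∀ j, j ≠ i → L i ⬝ᵥ q < L j ⬝ᵥ q

/-- Neighbouring actions: the cells share a boundary, i.e. `C_i ∩ C_j` is non-empty of affine
dimension `M - 2`. By convention every action is its own neighbour. -/
def Neighbor {N M : ℕ} (L : Matrix (Fin N) (Fin M) ℝ) (i j : Fin N) : Prop :=
  i = j ∨ ((cell L i ∩ cell L j).Nonempty ∧
    Module.finrank ℝ (vectorSpan ℝ (cell L i ∩ cell L j)) + 2 = M)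

open Classical in
/-- The neighbour set `N_i`. -/
def nbrs {N M : ℕ} (L : Matrix (Fin N) (Fin M) ℝ) (i : Fin N) : Finset (Fin N) :=
  Finset.univ.filter fun j => Neighbor L i j

/-- The expected signal matrix `Ξ_i (σ, j) = H_{i,j}(σ)`. Its rows are indexed by the whole
alphabet; signals outside the supports only contribute zero rows. -/
def signalMatrix {N M : ℕ} {A : Type*} [Fintype A] (H : Fin N → Fin M → stdSimplex ℝ A)
    (i : Fin N) : Matrix A (Fin M) ℝ :=
  Matrix.of fun σ j => (H i j : A → ℝ) σ

/-- `Ξ_{(i,j)}`: the matrix `Ξ_i` stacked on top of `Ξ_j`. -/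
def stackedMatrix {N M : ℕ} {A : Type*} [Fintype A] (H : Fin N → Fin M → stdSimplex ℝ A)
    (i j : Fin N) : Matrix (A ⊕ A) (Fin M) ℝ :=
  Matrix.fromRows (signalMatrix H i) (signalMatrix H j)

/-- Local observability: `ℓ_i - ℓ_j ∈ Im Ξ_{(i,j)}ᵀ` for all neighbouring actions. -/
def LocallyObservable {N M : ℕ} {A : Type*} [Fintype A] (L : Matrix (Fin N) (Fin M) ℝ)
    (H : Fin N → Fin M → stdSimplex ℝ A) : Prop :=
  ∀ i j, Neighbor L i j →
    L i - L j ∈ LinearMap.range (Matrix.mulVecLin (stackedMatrix H i j).transpose)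

/-- The vectors `v_{(i,j)}` satisfy `ℓ_j - ℓ_i = Ξ_{(i,j)}ᵀ v_{(i,j)}` for neighbouring actions. -/
def DifferenceVectors {N M : ℕ} {A : Type*} [Fintype A] (L : Matrix (Fin N) (Fin M) ℝ)
    (H : Fin N → Fin M → stdSimplex ℝ A) (v : Fin N → Fin N → A ⊕ A → ℝ) : Prop :=
  ∀ i j, Neighbor L i j →
    L j - L i = Matrix.mulVec (stackedMatrix H i j).transpose (v i j)

/-- `v̄`: the maximum of the sup norms of `v_{(i,j)}` over neighbouring pairs. -/
def vbar {N M : ℕ} {A : Type*} [Fintype A] (L : Matrix (Fin N) (Fin M) ℝ)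
    (v : Fin N → Fin N → A ⊕ A → ℝ) : ℝ :=
  ⨆ e : {e : Fin N × Fin N // Neighbor L e.1 e.2}, ‖v e.1.1 e.1.2‖

/-! ### The algorithm -/

/-- Exponential weights on the neighbour set `N_i` for the cumulative cost vector `F`. -/
def expWeights {N M : ℕ} (L : Matrix (Fin N) (Fin M) ℝ) (η : ℝ) (i : Fin N) (F : Fin N → ℝ)
    (j : Fin N) : ℝ :=
  if j ∈ nbrs L i then Real.exp (-η * F j) / ∑ k ∈ nbrs L i, Real.exp (-η * F k) else 0

/-- The memory of the local algorithms: `cum i` is the sum of the cost vectors that have been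
passed to the exponential weights of the `i`-th local algorithm, and `acc i` is the sum of the
estimates `b_{(i,·)}` made since that local algorithm was last run. -/
structure State (N : ℕ) where
  /-- cumulative cost vector of each local algorithm -/
  cum : Fin N → Fin N → ℝ
  /-- estimates accumulated since the last run of each local algorithm -/
  acc : Fin N → Fin N → ℝ

/-- The distribution `q_i = (1 - γ) x_i + (γ / |N_i|) 1_{N_i}` of the `i`-th local algorithm. -/
def localDist {N M : ℕ} (L : Matrix (Fin N) (Fin M) ℝ) (η γ : ℝ) (s : State N)
    (i j : Fin N) : ℝ :=
  (1 - γ) * expWeights L η i (s.cum i) j +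
    (if j ∈ nbrs L i then γ / ((nbrs L i).card : ℝ) else 0)

/-- What the player knows of one round: the drawn vertex `k`, the played action `I` and the
received signal. -/
abbrev Obs (N : ℕ) (A : Type*) := Fin N × Fin N × A

/-- The estimate `b_{(i,j)}` built from one round, where `q` is `q_i(j)` in that round. If the
played action is `I`, then `S_I e_{j_t}` is the unit vector of the received signal `o.2.2`. -/
def estimate {N M : ℕ} {A : Type*} (L : Matrix (Fin N) (Fin M) ℝ)
    (v : Fin N → Fin N → A ⊕ A → ℝ) (o : Obs N A) (i j : Fin N) (q : ℝ) : ℝ :=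
  if j ∈ nbrs L i then
    (if o.2.1 = i then v i j (Sum.inl o.2.2) else 0) +
      (if o.1 = i ∧ o.2.1 = j then v i j (Sum.inr o.2.2) / q else 0)
  else 0

/-- One round: every local algorithm adds its new estimates, and the local algorithm of the drawn
vertex `o.1` passes the accumulated cost to its exponential weights and starts afresh. -/
def State.update {N M : ℕ} {A : Type*} (L : Matrix (Fin N) (Fin M) ℝ)
    (v : Fin N → Fin N → A ⊕ A → ℝ) (η γ : ℝ) (s : State N) (o : Obs N A) : State N where
  cum i j := s.cum i j +
    (if o.1 = i then s.acc i j + estimate L v o i j (localDist L η γ s i j) else 0)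
  acc i j := if o.1 = i then 0 else s.acc i j + estimate L v o i j (localDist L η γ s i j)

/-- The memory after the observed rounds `l` (in chronological order). -/
def state {N M : ℕ} {A : Type*} (L : Matrix (Fin N) (Fin M) ℝ)
    (v : Fin N → Fin N → A ⊕ A → ℝ) (η γ : ℝ) (l : List (Obs N A)) : State N :=
  l.foldl (State.update L v η γ) ⟨fun _ _ => 0, fun _ _ => 0⟩

/-- The matrix `Q = [q_1, …, q_N]` (the `i`-th column is `q_i`) after the observed rounds `l`. -/
def flowMatrix {N M : ℕ} {A : Type*} (L : Matrix (Fin N) (Fin M) ℝ)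
    (v : Fin N → Fin N → A ⊕ A → ℝ) (η γ : ℝ) (l : List (Obs N A)) :
    Matrix (Fin N) (Fin N) ℝ :=
  Matrix.of fun j i => localDist L η γ (state L v η γ l) i j

/-- A rule `p` that finds, after any observed rounds, a distribution with `p = Q p`. -/
def StationaryRule {N M : ℕ} {A : Type*} (L : Matrix (Fin N) (Fin M) ℝ)
    (v : Fin N → Fin N → A ⊕ A → ℝ) (η γ : ℝ) (p : List (Obs N A) → Fin N → ℝ) : Prop :=
  ∀ l, p l ∈ stdSimplex ℝ (Fin N) ∧ p l = Matrix.mulVec (flowMatrix L v η γ l) (p l)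

/-! ### The repeated game and the regret -/

/-- One round of the play: the drawn vertex `k`, the player's action `I`, the opponent's action
`j`, and the signal. -/
abbrev Round (N M : ℕ) (A : Type*) := Fin N × Fin N × Fin M × A

/-- The part of a round that the player observes. -/
def Round.obs {N M : ℕ} {A : Type*} (r : Round N M A) : Obs N A := (r.1, r.2.1, r.2.2.2)

/-- An adaptive, possibly randomizing opponent: the complete past determines the mixed strategy
from which the next move is drawn. -/
abbrev Opponent (N M : ℕ) (A : Type*) := List (Round N M A) → stdSimplex ℝ (Fin M)

/-- The conditional probability of the next round `r = (k, I, j, σ)` given the past: `k` is drawn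
from `p`, `I` from `q_k`, `j` from the opponent's mixed strategy, and `σ` from `H_{I,j}`. -/
def roundProb {N M : ℕ} {A : Type*} [Fintype A] (L : Matrix (Fin N) (Fin M) ℝ)
    (H : Fin N → Fin M → stdSimplex ℝ A) (v : Fin N → Fin N → A ⊕ A → ℝ) (η γ : ℝ)
    (p : List (Obs N A) → Fin N → ℝ) (opp : Opponent N M A)
    (past : List (Round N M A)) (r : Round N M A) : ℝ :=
  p (past.map Round.obs) r.1 *
    flowMatrix L v η γ (past.map Round.obs) r.2.1 r.1 *
    (opp past : Fin M → ℝ) r.2.2.1 *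
    (H r.2.1 r.2.2.1 : A → ℝ) r.2.2.2

/-- The probability of the play `ω` of `T` rounds. -/
def playProb {N M : ℕ} {A : Type*} [Fintype A] (L : Matrix (Fin N) (Fin M) ℝ)
    (H : Fin N → Fin M → stdSimplex ℝ A) (v : Fin N → Fin N → A ⊕ A → ℝ) (η γ : ℝ)
    (p : List (Obs N A) → Fin N → ℝ) (opp : Opponent N M A) {T : ℕ}
    (ω : Fin T → Round N M A) : ℝ :=
  ∏ t : Fin T, roundProb L H v η γ p opp ((List.ofFn ω).take t) (ω t)

/-- The expected regret `E ∑_{t ≤ T} (e_{I_t} - e_{φ(I_t)})ᵀ L e_{j_t}` with respect to the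
departure function `φ`, as a sum over the finitely many plays of `T` rounds. -/
def expectedRegret {N M : ℕ} {A : Type*} [Fintype A] (L : Matrix (Fin N) (Fin M) ℝ)
    (H : Fin N → Fin M → stdSimplex ℝ A) (v : Fin N → Fin N → A ⊕ A → ℝ) (η γ : ℝ)
    (p : List (Obs N A) → Fin N → ℝ) (opp : Opponent N M A) (T : ℕ)
    (φ : Fin N → Fin N) : ℝ :=
  ∑ ω : Fin T → Round N M A, playProb L H v η γ p opp ω *
    ∑ t : Fin T, (L (ω t).2.1 (ω t).2.2.1 - L (φ (ω t).2.1) (ω t).2.2.1)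

/-- The departure functions `φ_{i → j}` of internal regret. -/
def internalDepartures (N : ℕ) : Set (Fin N → Fin N) :=
  {φ | ∃ i j, φ = Function.update id i j}

/-- The constant departure functions of external regret. -/
def externalDepartures (N : ℕ) : Set (Fin N → Fin N) :=
  {φ | ∃ k, φ = fun _ => k}

end PartialMonitoring

end

namespace PartialMonitoring

/-! The argument reduces regret to neighbouring actions and bounds each local algorithm by a
potential.

Geometry. In a non-degenerate game the constraints of the neighbours alone cut `C_i` out of the
simplex (`Nondegenerate.describes_nbrs`): in a minimal describing set, every constraint other than
that of `i` itself is the only active one at some interior point, so it gives a common boundary of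
dimension M - 2. A quantitative form (`Nondegenerate.exists_regret_le`), applied to the expected
occupation measure of the opponent's moves while `i` is played, bounds the regret of every departure
function by a constant times the regret of departures to neighbours.

Flow. Since p = Qp, the played action and the drawn vertex have the same law p. Hence the estimates
are unbiased up to the factor p_i (`sum_roundProb_mul_estimate`), and the regrets of the local
algorithms add up to the player's (`regretRate_eq_sum_localRegret`).

Local regret. Between two runs of the i-th local algorithm its distribution is frozen, so the
delayed cost vector loses nothing to first order. The second order cost of a run is quadratic in the
number G of plays of `i` since the last run, and G is unbounded. But G grows with probability at
most p_i and is reset with probability p_i, so adding 2KG² to the potential leaves a drift of at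
most 12K per round (`localRegret_drift`), where K is of order η + γ. Telescoping over T rounds with
η and γ of order 1/√T gives √T; short horizons are covered by the trivial linear bound. -/

/-- A column-stochastic matrix has a stationary distribution. -/
theorem exists_stationary {n : Type*} [Fintype n] [DecidableEq n] [Nonempty n] (Q : Matrix n n ℝ)
    (h0 : ∀ i j, 0 ≤ Q i j) (h1 : ∀ j, ∑ i, Q i j = 1) :
    ∃ p ∈ stdSimplex ℝ n, p = Q.mulVec p := by
  have hdet : (Q - 1).det = 0 := by
    -- Column sums equal to one make the all-ones vector a left null vector of Q - 1.
    rw [← Matrix.exists_vecMul_eq_zero_iff]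
    refine ⟨1, one_ne_zero, ?_⟩
    ext j
    simp [Matrix.vecMul, dotProduct, Finset.sum_sub_distrib, h1, Matrix.one_apply]
  obtain ⟨x, hx0, hx⟩ := Matrix.exists_mulVec_eq_zero_iff.2 hdet
  have hx' : ∀ i, ∑ j, Q i j * x j = x i := by
    intro i
    have := congrFun hx i
    rw [Matrix.sub_mulVec, Matrix.one_mulVec] at this
    simpa [Matrix.mulVec, dotProduct, sub_eq_zero] using this
  have hle : ∀ i ∈ Finset.univ, |x i| ≤ ∑ j, Q i j * |x j| := by
    intro i _
    rw [← hx' i]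
    refine (Finset.abs_sum_le_sum_abs _ _).trans (le_of_eq ?_)
    exact Finset.sum_congr rfl fun j _ => by rw [abs_mul, abs_of_nonneg (h0 i j)]
  have hsum : ∑ i, |x i| = ∑ i, ∑ j, Q i j * |x j| := by
    rw [Finset.sum_comm]
    simp [← Finset.sum_mul, h1]
  -- The coordinatewise inequality |x| ≤ Q|x| has equal totals on both sides, so |x| is itself a
  -- fixed vector.
  have heq := (Finset.sum_eq_sum_iff_of_le hle).1 hsum
  have hpos : 0 < ∑ i, |x i| := by
    obtain ⟨i, hi⟩ := Function.ne_iff.1 hx0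
    exact Finset.sum_pos' (fun _ _ => abs_nonneg _) ⟨i, Finset.mem_univ _, abs_pos.2 hi⟩
  refine ⟨fun i => |x i| / ∑ i, |x i|, ⟨fun i => by positivity, ?_⟩, ?_⟩
  · rw [← Finset.sum_div, div_self hpos.ne']
  · ext i
    simp only [Matrix.mulVec, dotProduct, mul_div_assoc']
    rw [← Finset.sum_div, ← heq i (Finset.mem_univ _)]

theorem ofFn_snoc {R : Type*} {T : ℕ} (ω : Fin T → R) (r : R) :
    List.ofFn (Fin.snoc ω r : Fin (T + 1) → R) = List.ofFn ω ++ [r] := by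
  rw [List.ofFn_succ_last]
  simp

/-! ### Expectations over finite random paths -/

section Paths

variable {R : Type*} [Fintype R]

/-- The expectation of `G` over the first `T` steps of the process whose next step has
conditional weights `w` given the past. -/
noncomputable def pathExp (w : List R → R → ℝ) (T : ℕ) (G : List R → ℝ) : ℝ :=
  ∑ ω : Fin T → R, (∏ t : Fin T, w ((List.ofFn ω).take t) (ω t)) * G (List.ofFn ω)

theorem pathExp_zero (w : List R → R → ℝ) (G : List R → ℝ) : pathExp w 0 G = G [] := by
  simp [pathExp]

/-- The tower property: the first T weights depend only on the prefix, so the last step can be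
averaged out first. -/
theorem pathExp_succ (w : List R → R → ℝ) (T : ℕ) (G : List R → ℝ) :
    pathExp w (T + 1) G = pathExp w T fun l => ∑ r, w l r * G (l ++ [r]) := by
  unfold pathExp
  rw [← (Fin.snocEquiv fun _ : Fin (T + 1) => R).sum_comp, Fintype.sum_prod_type,
    Finset.sum_comm]
  refine Finset.sum_congr rfl fun ω _ => ?_
  rw [Finset.mul_sum]
  refine Finset.sum_congr rfl fun r _ => ?_
  have hs : (Fin.snocEquiv fun _ : Fin (T + 1) => R) (r, ω) = Fin.snoc ω r := rfl
  rw [hs, Fin.prod_univ_castSucc, ofFn_snoc, ← mul_assoc]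
  congr 2
  · refine Finset.prod_congr rfl fun t _ => ?_
    rw [Fin.snoc_castSucc, Fin.val_castSucc, List.take_append_of_le_length (by simp [t.2.le])]
  · rw [Fin.snoc_last, Fin.val_last, List.take_append_of_le_length (by simp),
      List.take_of_length_le (by simp)]

theorem pathExp_add (w : List R → R → ℝ) (T : ℕ) (G G' : List R → ℝ) :
    pathExp w T (fun l => G l + G' l) = pathExp w T G + pathExp w T G' := by
  simp [pathExp, mul_add, Finset.sum_add_distrib]

theorem pathExp_mul_left (w : List R → R → ℝ) (T : ℕ) (c : ℝ) (G : List R → ℝ) :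
    pathExp w T (fun l => c * G l) = c * pathExp w T G := by
  simp [pathExp, Finset.mul_sum, mul_left_comm]

theorem pathExp_sum {ι : Type*} (s : Finset ι) (w : List R → R → ℝ) (T : ℕ)
    (G : ι → List R → ℝ) :
    pathExp w T (fun l => ∑ i ∈ s, G i l) = ∑ i ∈ s, pathExp w T (G i) := by
  simp only [pathExp, Finset.mul_sum]
  exact Finset.sum_comm

theorem pathExp_mono {w : List R → R → ℝ} (hw : ∀ l r, 0 ≤ w l r) (T : ℕ)
    {G G' : List R → ℝ} (h : ∀ l, G l ≤ G' l) : pathExp w T G ≤ pathExp w T G' :=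
  Finset.sum_le_sum fun _ _ =>
    mul_le_mul_of_nonneg_left (h _) (Finset.prod_nonneg fun _ _ => hw _ _)

theorem pathExp_const {w : List R → R → ℝ} (h1 : ∀ l, ∑ r, w l r = 1) (T : ℕ) (c : ℝ) :
    pathExp w T (fun _ => c) = c := by
  induction T with
  | zero => exact pathExp_zero _ _
  | succ T ih => rw [pathExp_succ]; simpa [← Finset.sum_mul, h1] using ih

theorem pathExp_nonneg {w : List R → R → ℝ} (hw : ∀ l r, 0 ≤ w l r) (T : ℕ)
    {G : List R → ℝ} (h : ∀ l, 0 ≤ G l) : 0 ≤ pathExp w T G :=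
  Finset.sum_nonneg fun _ _ => mul_nonneg (Finset.prod_nonneg fun _ _ => hw _ _) (h _)

theorem pathExp_list_sum {w : List R → R → ℝ} (h1 : ∀ l, ∑ r, w l r = 1) (T : ℕ) (g : R → ℝ) :
    pathExp w T (fun l => (l.map g).sum) =
      ∑ t ∈ Finset.range T, pathExp w t fun l => ∑ r, w l r * g r := by
  induction T with
  | zero => simp [pathExp_zero]
  | succ T ih =>
    rw [pathExp_succ, Finset.sum_range_succ, ← ih, ← pathExp_add]
    congr 1
    ext l
    simp [mul_add, Finset.sum_add_distrib, ← Finset.sum_mul, h1]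

/-- The expected sum of the terms `d` is controlled by a potential `V`. -/
theorem sum_pathExp_le_of_drift {w : List R → R → ℝ} (hw : ∀ l r, 0 ≤ w l r)
    (h1 : ∀ l, ∑ r, w l r = 1) {d V : List R → ℝ} {c : ℝ}
    (h : ∀ l, d l + ∑ r, w l r * V (l ++ [r]) ≤ V l + c) (T : ℕ) :
    ∑ t ∈ Finset.range T, pathExp w t d ≤ c * T + V [] - pathExp w T V := by
  induction T with
  | zero => simp [pathExp_zero]
  | succ T ih =>
    have := pathExp_mono hw T h
    rw [pathExp_add, pathExp_add, pathExp_const h1, ← pathExp_succ] at this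
    rw [Finset.sum_range_succ]
    push_cast
    linarith

end Paths

/-! ### The potential of exponential weights -/

section ExpWeights

variable {N M : ℕ}

/-- The potential of exponential weights with cumulative costs `F` on the neighbour set `N_i`. -/
noncomputable def ewPotential (L : Matrix (Fin N) (Fin M) ℝ) (η : ℝ) (i : Fin N)
    (F : Fin N → ℝ) : ℝ :=
  -(Real.log (∑ h ∈ nbrs L i, Real.exp (-η * F h)) / η)

theorem mem_nbrs {L : Matrix (Fin N) (Fin M) ℝ} {i j : Fin N} :
    j ∈ nbrs L i ↔ Neighbor L i j := by
  simp [nbrs]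

theorem self_mem_nbrs (L : Matrix (Fin N) (Fin M) ℝ) (i : Fin N) : i ∈ nbrs L i :=
  mem_nbrs.2 (Or.inl rfl)

theorem sum_exp_pos (L : Matrix (Fin N) (Fin M) ℝ) (η : ℝ) (i : Fin N) (F : Fin N → ℝ) :
    0 < ∑ h ∈ nbrs L i, Real.exp (-η * F h) :=
  Finset.sum_pos (fun _ _ => Real.exp_pos _) ⟨i, self_mem_nbrs L i⟩

theorem expWeights_nonneg (L : Matrix (Fin N) (Fin M) ℝ) (η : ℝ) (i : Fin N) (F : Fin N → ℝ)
    (j : Fin N) : 0 ≤ expWeights L η i F j := by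
  unfold expWeights
  split_ifs <;> positivity

theorem sum_expWeights (L : Matrix (Fin N) (Fin M) ℝ) (η : ℝ) (i : Fin N) (F : Fin N → ℝ) :
    ∑ j ∈ nbrs L i, expWeights L η i F j = 1 := by
  have h : ∀ j ∈ nbrs L i, expWeights L η i F j =
      Real.exp (-η * F j) / ∑ k ∈ nbrs L i, Real.exp (-η * F k) := fun j hj => if_pos hj
  rw [Finset.sum_congr rfl h, ← Finset.sum_div, div_self (sum_exp_pos L η i F).ne']

theorem ewPotential_le (L : Matrix (Fin N) (Fin M) ℝ) {η : ℝ} (hη : 0 < η) {i j : Fin N}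
    (hj : j ∈ nbrs L i) (F : Fin N → ℝ) : ewPotential L η i F ≤ F j := by
  have h : -η * F j ≤ Real.log (∑ h ∈ nbrs L i, Real.exp (-η * F h)) := by
    rw [Real.le_log_iff_exp_le (sum_exp_pos L η i F)]
    exact Finset.single_le_sum (f := fun h => Real.exp (-η * F h))
      (fun _ _ => (Real.exp_pos _).le) hj
  rw [ewPotential, neg_le, le_div_iff₀ hη]
  linarith

theorem neg_ewPotential_zero_le (L : Matrix (Fin N) (Fin M) ℝ) {η : ℝ} (hη : 0 < η)
    (i : Fin N) : -ewPotential L η i 0 ≤ Real.log N / η := by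
  have h : ((nbrs L i).card : ℝ) ≤ N := by
    exact_mod_cast (Finset.card_le_univ _).trans_eq (Fintype.card_fin N)
  have h' : 0 < ((nbrs L i).card : ℝ) := by
    exact_mod_cast Finset.card_pos.2 ⟨i, self_mem_nbrs L i⟩
  simp only [ewPotential, Pi.zero_apply, mul_zero, Real.exp_zero, Finset.sum_const, nsmul_eq_mul,
    mul_one, neg_neg]
  gcongr

theorem ewPotential_add (L : Matrix (Fin N) (Fin M) ℝ) (η : ℝ) (i : Fin N) (F f : Fin N → ℝ) :
    ewPotential L η i (fun h => F h + f h) - ewPotential L η i F =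
      -(Real.log (∑ h ∈ nbrs L i, expWeights L η i F h * Real.exp (-η * f h)) / η) := by
  have hZ := sum_exp_pos L η i F
  have h : ∑ h ∈ nbrs L i, expWeights L η i F h * Real.exp (-η * f h) =
      (∑ h ∈ nbrs L i, Real.exp (-η * (F h + f h))) / ∑ h ∈ nbrs L i, Real.exp (-η * F h) := by
    rw [Finset.sum_div]
    refine Finset.sum_congr rfl fun h hh => ?_
    rw [expWeights, if_pos hh, mul_add, Real.exp_add]
    ring
  rw [h, Real.log_div (sum_exp_pos L η i fun h => F h + f h).ne' hZ.ne', ewPotential, ewPotential]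
  ring

/-- One step of exponential weights, for costs that may be large at a single coordinate `h₀`. -/
theorem sum_expWeights_mul_le (L : Matrix (Fin N) (Fin M) ℝ) {η a b : ℝ} (hη : 0 < η)
    (ha : 0 ≤ a) (hηb : η * b ≤ 1 / 2) {i h₀ : Fin N} (hh₀ : h₀ ∈ nbrs L i)
    (F f : Fin N → ℝ) (hf : ∀ h ∈ nbrs L i, |f h| ≤ a + if h = h₀ then b else 0) :
    ∑ h ∈ nbrs L i, expWeights L η i F h * f h ≤
      ewPotential L η i (fun h => F h + f h) - ewPotential L η i F +
        η * (8 * a ^ 2 + 2 * expWeights L η i F h₀ * b ^ 2) := by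
  rw [ewPotential_add]
  set x := expWeights L η i F with hx
  have hx0 : ∀ h, 0 ≤ x h := expWeights_nonneg L η i F
  have hx1 : ∑ h ∈ nbrs L i, x h = 1 := sum_expWeights L η i F
  set Y := ∑ h ∈ nbrs L i, x h * Real.exp (-η * f h) with hY
  -- The bound `a` will grow with the waiting time between runs, so `η * a` need not be small. When
  -- it is, all exponents have modulus at most 1 and exp(-y) ≤ 1 - y + y² applies.
  rcases le_or_gt (η * a) (1 / 2) with h | h
  · have hsq : ∑ h ∈ nbrs L i, x h * f h ^ 2 ≤ 2 * a ^ 2 + 2 * x h₀ * b ^ 2 := by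
      calc ∑ h ∈ nbrs L i, x h * f h ^ 2
          ≤ ∑ h ∈ nbrs L i, (x h * (2 * a ^ 2) + if h = h₀ then x h * (2 * b ^ 2) else 0) := by
            refine Finset.sum_le_sum fun h hh => ?_
            have h1 : f h ^ 2 ≤ (a + if h = h₀ then b else 0) ^ 2 := by
              rw [← sq_abs]
              exact pow_le_pow_left₀ (abs_nonneg _) (hf h hh) 2
            have h2 := mul_le_mul_of_nonneg_left h1 (hx0 h)
            refine h2.trans ?_
            split_ifs
            · rw [← mul_add]
              exact mul_le_mul_of_nonneg_left (by nlinarith [sq_nonneg (a - b)]) (hx0 h)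
            · rw [add_zero, add_zero]
              exact mul_le_mul_of_nonneg_left (by nlinarith [sq_nonneg a]) (hx0 h)
        _ = 2 * a ^ 2 + 2 * x h₀ * b ^ 2 := by
            rw [Finset.sum_add_distrib, ← Finset.sum_mul, hx1, Finset.sum_ite_eq' _ _ _,
              if_pos hh₀]
            ring
    have hYle : Y ≤ 1 - η * ∑ h ∈ nbrs L i, x h * f h +
        η ^ 2 * ∑ h ∈ nbrs L i, x h * f h ^ 2 := by
      rw [← hx1, Finset.mul_sum, Finset.mul_sum, ← Finset.sum_sub_distrib,
        ← Finset.sum_add_distrib]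
      refine Finset.sum_le_sum fun h' hh => ?_
      have h1 : |-η * f h'| ≤ 1 := by
        rw [abs_mul, abs_neg, abs_of_pos hη]
        have := mul_le_mul_of_nonneg_left (hf h' hh) hη.le
        have h3 : η * (a + if h' = h₀ then b else 0) ≤ 1 := by
          split_ifs <;> nlinarith
        linarith
      have h2 := (abs_le.1 (Real.abs_exp_sub_one_sub_id_le h1)).2
      nlinarith [mul_le_mul_of_nonneg_left h2 (hx0 h')]
    have hYpos : 0 < Y := by
      rw [hY]
      refine Finset.sum_pos (fun h hh => mul_pos ?_ (Real.exp_pos _)) ⟨i, self_mem_nbrs L i⟩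
      rw [hx, expWeights, if_pos hh]
      exact div_pos (Real.exp_pos _) (sum_exp_pos L η i F)
    have hlog := Real.log_le_sub_one_of_pos hYpos
    have h1 : Real.log Y / η ≤
        -∑ h ∈ nbrs L i, x h * f h + η * ∑ h ∈ nbrs L i, x h * f h ^ 2 := by
      rw [div_le_iff₀ hη]
      nlinarith
    have h2 := mul_le_mul_of_nonneg_left hsq hη.le
    nlinarith [mul_nonneg hη.le (sq_nonneg a)]
  -- For large `η * a` the crude bound suffices: both the mean cost and the negated potential
  -- difference are at most 2a, and 4a < 8ηa². This is the source of the factor 8.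
  · have hba : b ≤ a := by
      by_contra hlt
      nlinarith [mul_lt_mul_of_pos_left (not_le.1 hlt) hη]
    have hf2 : ∀ h ∈ nbrs L i, |f h| ≤ 2 * a := fun h hh => by
      refine (hf h hh).trans ?_
      split_ifs <;> linarith
    have h1 : ∑ h ∈ nbrs L i, x h * f h ≤ 2 * a := by
      calc ∑ h ∈ nbrs L i, x h * f h ≤ ∑ h ∈ nbrs L i, x h * (2 * a) :=
            Finset.sum_le_sum fun h hh =>
              mul_le_mul_of_nonneg_left (abs_le.1 (hf2 h hh)).2 (hx0 h)
        _ = 2 * a := by rw [← Finset.sum_mul, hx1, one_mul]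
    have h2 : Y ≤ Real.exp (η * (2 * a)) := by
      calc Y ≤ ∑ h ∈ nbrs L i, x h * Real.exp (η * (2 * a)) := by
            refine Finset.sum_le_sum fun h hh => mul_le_mul_of_nonneg_left ?_ (hx0 h)
            rw [Real.exp_le_exp]
            nlinarith [(abs_le.1 (hf2 h hh)).1]
        _ = _ := by rw [← Finset.sum_mul, hx1, one_mul]
    have hYpos : 0 < Y := by
      rw [hY]
      refine Finset.sum_pos (fun h hh => mul_pos ?_ (Real.exp_pos _)) ⟨i, self_mem_nbrs L i⟩
      rw [hx, expWeights, if_pos hh]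
      exact div_pos (Real.exp_pos _) (sum_exp_pos L η i F)
    have h3 : Real.log Y / η ≤ 2 * a := by
      rw [div_le_iff₀ hη, mul_comm]
      exact (Real.log_le_iff_le_exp hYpos).2 h2
    have h4 : 0 ≤ η * (2 * x h₀ * b ^ 2) := by have := hx0 h₀; positivity
    nlinarith

end ExpWeights

/-! ### Cells, their facets and regret against neighbours -/

section Geometry

variable {N M : ℕ}

/-- In a non-degenerate game every action is the unique best response to some mixed strategy of
full support. -/
theorem Nondegenerate.exists_pos {L : Matrix (Fin N) (Fin M) ℝ} (hL : Nondegenerate L)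
    (i : Fin N) : ∃ q ∈ stdSimplex ℝ (Fin M), (∀ m, 0 < q m) ∧
      ∀ j, j ≠ i → L i ⬝ᵥ q < L j ⬝ᵥ q := by
  obtain ⟨q, hq, hlt⟩ := hL i
  have hM : (0 : ℝ) < M := by
    rcases Nat.eq_zero_or_pos M with h | h
    · subst h
      simpa using hq.2
    · exact_mod_cast h
  -- Strict inequalities survive a small move towards the barycentre, which makes every coordinate
  -- positive.
  let f : ℝ → Fin M → ℝ := fun ε => (1 - ε) • q + ε • fun _ => (M : ℝ)⁻¹
  have hf : Continuous f := by fun_prop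
  have h1 : ∀ᶠ ε in nhdsWithin (0 : ℝ) (Set.Ioi 0), ∀ j, j ≠ i → L i ⬝ᵥ f ε < L j ⬝ᵥ f ε := by
    refine nhdsWithin_le_nhds (Filter.eventually_all.2 fun j => ?_)
    by_cases hj : j = i
    · simp [hj]
    · have hc : ∀ k, Continuous fun ε => L k ⬝ᵥ f ε := fun k => by
        unfold dotProduct
        fun_prop
      have h0 : L i ⬝ᵥ f 0 < L j ⬝ᵥ f 0 := by simpa [f] using hlt j hj
      filter_upwards [(hc i).continuousAt.eventually_lt (hc j).continuousAt h0] with ε h _ using h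
  have h2 : ∀ᶠ ε in nhdsWithin (0 : ℝ) (Set.Ioi 0), ε < 1 :=
    nhdsWithin_le_nhds (Iio_mem_nhds one_pos)
  obtain ⟨ε, ⟨hε, hε1⟩, hε0⟩ := ((h1.and h2).and self_mem_nhdsWithin).exists
  have hε0 : 0 < ε := hε0
  have hpos : ∀ m, 0 < f ε m := fun m => by
    have : 0 ≤ (1 - ε) * q m := mul_nonneg (by linarith) (hq.1 m)
    simp only [f, Pi.add_apply, Pi.smul_apply, smul_eq_mul]
    positivity
  refine ⟨f ε, ⟨fun m => (hpos m).le, ?_⟩, hpos, hε⟩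
  have : (1 - ε) * ∑ m, q m + M * (ε * (M : ℝ)⁻¹) = 1 := by
    rw [hq.2]
    field_simp
    ring
  simpa [f, Finset.sum_add_distrib, ← Finset.mul_sum] using this

/-- The linear map whose kernel is the direction of the hyperplane `ℓ_i · q = ℓ_j · q` of the
simplex. -/
noncomputable def boundaryMap (L : Matrix (Fin N) (Fin M) ℝ) (i j : Fin N) :
    (Fin M → ℝ) →ₗ[ℝ] ℝ × ℝ where
  toFun d := (∑ m, d m, (L i - L j) ⬝ᵥ d)
  map_add' x y := by simp [Finset.sum_add_distrib, dotProduct_add]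
  map_smul' c x := by simp [Finset.mul_sum, dotProduct_smul]

/-- The images of w and q are (1, 0) and (1, c) with c ≠ 0. They span the plane, so rank-nullity
gives M - 2. -/
theorem finrank_ker_boundaryMap {L : Matrix (Fin N) (Fin M) ℝ} {i j : Fin N} {q w : Fin M → ℝ}
    (hq : ∑ m, q m = 1) (hw : ∑ m, w m = 1) (hqlt : L i ⬝ᵥ q < L j ⬝ᵥ q)
    (hweq : L i ⬝ᵥ w = L j ⬝ᵥ w) :
    Module.finrank ℝ (LinearMap.ker (boundaryMap L i j)) + 2 = M := by
  have hsurj : Function.Surjective (boundaryMap L i j) := by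
    rintro ⟨a, b⟩
    have hB : L i ⬝ᵥ q - L j ⬝ᵥ q ≠ 0 := (sub_neg.2 hqlt).ne
    refine ⟨(a - b / (L i ⬝ᵥ q - L j ⬝ᵥ q)) • w + (b / (L i ⬝ᵥ q - L j ⬝ᵥ q)) • q, ?_⟩
    have hw' : boundaryMap L i j w = (1, 0) := by
      simp [boundaryMap, hw, sub_dotProduct, hweq]
    have hq' : boundaryMap L i j q = (1, L i ⬝ᵥ q - L j ⬝ᵥ q) := by
      simp [boundaryMap, hq, sub_dotProduct]
    rw [map_add, map_smul, map_smul, hw', hq']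
    ext
    · simp
    · simp [hB]
  have h := LinearMap.finrank_range_add_finrank_ker (boundaryMap L i j)
  rw [LinearMap.range_eq_top.2 hsurj, finrank_top, Module.finrank_prod, Module.finrank_self,
    Module.finrank_fin_fun] at h
  omega

theorem vectorSpan_le_ker_boundaryMap (L : Matrix (Fin N) (Fin M) ℝ) (i j : Fin N) :
    vectorSpan ℝ (cell L i ∩ cell L j) ≤ LinearMap.ker (boundaryMap L i j) := by
  rw [vectorSpan, Submodule.span_le]
  rintro _ ⟨x, hx, y, hy, rfl⟩
  have hx' := le_antisymm (hx.1.2 j) (hx.2.2 i)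
  have hy' := le_antisymm (hy.1.2 j) (hy.2.2 i)
  have hxs := hx.1.1.2
  have hys := hy.1.1.2
  simp [boundaryMap, dotProduct_sub, sub_dotProduct, hx', hy', hxs, hys]

/-- A set `S` of constraints that describes the cell of `i` within the simplex. -/
def Describes (L : Matrix (Fin N) (Fin M) ℝ) (i : Fin N) (S : Finset (Fin N)) : Prop :=
  ∀ q ∈ stdSimplex ℝ (Fin M), (∀ j ∈ S, L i ⬝ᵥ q ≤ L j ⬝ᵥ q) → q ∈ cell L i

/-- If `w` lies in the relative interior of the simplex and the constraint of `j` is the only one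
active at `w`, then `i` and `j` are neighbours. -/
theorem neighbor_of_active {L : Matrix (Fin N) (Fin M) ℝ} {i j : Fin N} {S : Finset (Fin N)}
    (hS : Describes L i S) {q w : Fin M → ℝ} (hq : ∑ m, q m = 1) (hqlt : L i ⬝ᵥ q < L j ⬝ᵥ q)
    (hw : w ∈ stdSimplex ℝ (Fin M)) (hwpos : ∀ m, 0 < w m) (hweq : L i ⬝ᵥ w = L j ⬝ᵥ w)
    (hwlt : ∀ k ∈ S, k ≠ j → k ≠ i → L i ⬝ᵥ w < L k ⬝ᵥ w) : Neighbor L i j := by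
  have hmem : ∀ z ∈ stdSimplex ℝ (Fin M), L i ⬝ᵥ z = L j ⬝ᵥ z →
      (∀ k ∈ S, k ≠ j → k ≠ i → L i ⬝ᵥ z < L k ⬝ᵥ z) → z ∈ cell L i ∩ cell L j := by
    intro z hz heq hlt
    have hzi : z ∈ cell L i := hS z hz fun k hk => by
      by_cases hkj : k = j
      · rw [hkj, heq]
      · by_cases hki : k = i
        · rw [hki]
        · exact (hlt k hk hkj hki).le
    exact ⟨hzi, hz, fun k => heq ▸ hzi.2 k⟩
  have hwmem := hmem w hw hweq hwlt
  have hspan : vectorSpan ℝ (cell L i ∩ cell L j) = LinearMap.ker (boundaryMap L i j) := by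
    refine le_antisymm (vectorSpan_le_ker_boundaryMap L i j) fun d hd => ?_
    have hd' : boundaryMap L i j d = 0 := hd
    have hd1 : ∑ m, d m = 0 := congrArg Prod.fst hd'
    have hd2 : L i ⬝ᵥ d - L j ⬝ᵥ d = 0 := by
      rw [← sub_dotProduct]
      exact congrArg Prod.snd hd'
    -- A short move from w along a kernel direction d keeps the total mass, the tie between i and j,
    -- and all strict inequalities. It stays in both cells, so d is a multiple of a difference of
    -- two of their common points.
    let f : ℝ → Fin M → ℝ := fun ε => w + ε • d
    have hf : Continuous f := by fun_prop
    have hf0 : f 0 = w := by simp [f]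
    have h1 : ∀ᶠ ε in nhdsWithin (0 : ℝ) (Set.Ioi 0), ∀ m, 0 < f ε m := by
      refine nhdsWithin_le_nhds (Filter.eventually_all.2 fun m => ?_)
      have hc : Continuous fun ε => f ε m := by fun_prop
      exact continuousAt_const.eventually_lt hc.continuousAt (by rw [hf0]; exact hwpos m)
    have h2 : ∀ᶠ ε in nhdsWithin (0 : ℝ) (Set.Ioi 0),
        ∀ k, k ∈ S → k ≠ j → k ≠ i → L i ⬝ᵥ f ε < L k ⬝ᵥ f ε := by
      refine nhdsWithin_le_nhds (Filter.eventually_all.2 fun k => ?_)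
      have hc : ∀ k, Continuous fun ε => L k ⬝ᵥ f ε := fun k => by
        unfold dotProduct
        fun_prop
      by_cases hk : k ∈ S ∧ k ≠ j ∧ k ≠ i
      · filter_upwards [(hc i).continuousAt.eventually_lt (hc k).continuousAt
          (by rw [hf0]; exact hwlt k hk.1 hk.2.1 hk.2.2)] with ε h _ _ _ using h
      · exact Filter.Eventually.of_forall fun ε hkS hkj hki => absurd ⟨hkS, hkj, hki⟩ hk
    obtain ⟨ε, ⟨hεpos, hεlt⟩, hε0⟩ := ((h1.and h2).and self_mem_nhdsWithin).exists
    have hε0 : ε ≠ 0 := (Set.mem_Ioi.1 hε0).ne'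
    have hfm : f ε ∈ cell L i ∩ cell L j := by
      refine hmem _ ⟨fun m => (hεpos m).le, ?_⟩ ?_ hεlt
      · simp [f, Finset.sum_add_distrib, ← Finset.mul_sum, hd1, hw.2]
      · simp only [f, dotProduct_add, dotProduct_smul, smul_eq_mul, hweq]
        rw [sub_eq_zero.1 hd2]
    have hsub := vsub_mem_vectorSpan ℝ hfm hwmem
    have : d = ε⁻¹ • (f ε -ᵥ w) := by simp [f, smul_smul, hε0]
    rw [this]
    exact Submodule.smul_mem _ _ hsub
  exact Or.inr ⟨⟨w, hwmem⟩, by rw [hspan]; exact finrank_ker_boundaryMap hq hw.2 hqlt hweq⟩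

/-- The cell of `i` is described by the constraints of its neighbours. -/
theorem Nondegenerate.describes_nbrs {L : Matrix (Fin N) (Fin M) ℝ} (hL : Nondegenerate L)
    (i : Fin N) : Describes L i (nbrs L i) := by
  obtain ⟨q, hq, hqpos, hqlt⟩ := hL.exists_pos i
  have huniv : Describes L i Finset.univ := fun z hz h => ⟨hz, fun j => h j (Finset.mem_univ j)⟩
  obtain ⟨S, hS⟩ := exists_minimal_of_wellFoundedLT (Describes L i) ⟨_, huniv⟩
  suffices h : S ⊆ nbrs L i from fun z hz hz' => hS.prop z hz fun j hj => hz' j (h hj)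
  intro j hj
  rw [mem_nbrs]
  by_cases hij : j = i
  · exact Or.inl hij.symm
  have herase : ¬ Describes L i (S.erase j) := fun h =>
    Finset.notMem_erase j S (hS.le_of_le h (Finset.erase_subset j S) hj)
  -- By minimality, dropping j admits a point z outside the cell; z can violate only the constraint
  -- of j.
  simp only [Describes, not_forall] at herase
  obtain ⟨z, hz, hzle, hzn⟩ := herase
  have hzj : L j ⬝ᵥ z < L i ⬝ᵥ z := by
    by_contra hle
    refine hzn (hS.prop z hz fun k hk => ?_)
    by_cases hkj : k = j
    · exact hkj ▸ not_lt.1 hle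
    · exact hzle k (Finset.mem_erase.2 ⟨hkj, hk⟩)
  -- The violation `a` at z and the slack `b` at q are the weights that place the crossing of the
  -- segment with the hyperplane of i and j. The positive share of q makes the other constraints
  -- strict and the coordinates positive there.
  set a := L i ⬝ᵥ z - L j ⬝ᵥ z with ha
  set b := L j ⬝ᵥ q - L i ⬝ᵥ q with hb
  have ha0 : 0 < a := sub_pos.2 hzj
  have hb0 : 0 < b := sub_pos.2 (hqlt j hij)
  have hs0 : 0 < a / (a + b) := by positivity
  have hs1 : 0 < b / (a + b) := by positivity
  have hsum : b / (a + b) + a / (a + b) = 1 := by field_simp; ring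
  have hdot : ∀ k, L k ⬝ᵥ ((b / (a + b)) • z + (a / (a + b)) • q) =
      b / (a + b) * (L k ⬝ᵥ z) + a / (a + b) * (L k ⬝ᵥ q) := fun k => by
    simp [dotProduct_add, dotProduct_smul]
  refine neighbor_of_active hS.prop (w := (b / (a + b)) • z + (a / (a + b)) • q) hq.2
    (hqlt j hij) (convex_stdSimplex ℝ _ hz hq hs1.le hs0.le hsum) (fun m => ?_) ?_ ?_
  · have h1 := mul_nonneg hs1.le (hz.1 m)
    have h2 := mul_pos hs0 (hqpos m)
    simp only [Pi.add_apply, Pi.smul_apply, smul_eq_mul]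
    linarith
  · rw [hdot, hdot, ← sub_eq_zero]
    have : b / (a + b) * a - a / (a + b) * b = 0 := by ring
    rw [ha, hb] at this
    rw [ha, hb]
    linarith
  · intro k hk hkj hki
    rw [hdot, hdot]
    have h1 := mul_le_mul_of_nonneg_left (hzle k (Finset.mem_erase.2 ⟨hkj, hk⟩)) hs1.le
    have h2 := mul_lt_mul_of_pos_left (hqlt k hki) hs0
    linarith

/-- The regret of `i` against any action is controlled by the regret against its neighbours. -/
theorem Nondegenerate.exists_regret_le {L : Matrix (Fin N) (Fin M) ℝ} (hL : Nondegenerate L)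
    (i : Fin N) : ∃ K : ℝ, 0 ≤ K ∧ ∀ (y : Fin M → ℝ) (B : ℝ), (∀ m, 0 ≤ y m) → 0 ≤ B →
      (∀ j ∈ nbrs L i, (L i - L j) ⬝ᵥ y ≤ B) → ∀ k, (L i - L k) ⬝ᵥ y ≤ K * B := by
  obtain ⟨q, hq, hqpos, hqlt⟩ := hL.exists_pos i
  have hcone : ∀ z : Fin M → ℝ, (∀ m, 0 ≤ z m) → (∀ j ∈ nbrs L i, L i ⬝ᵥ z ≤ L j ⬝ᵥ z) →
      ∀ k, L i ⬝ᵥ z ≤ L k ⬝ᵥ z := by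
    intro z hz hle k
    rcases (Finset.sum_nonneg fun m (_ : m ∈ Finset.univ) => hz m).eq_or_lt with h | h
    · have : z = 0 := by
        ext m
        exact (Finset.sum_eq_zero_iff_of_nonneg fun m _ => hz m).1 h.symm m (Finset.mem_univ m)
      simp [this]
    · have := (hL.describes_nbrs i ((∑ m, z m)⁻¹ • z) ⟨fun m => ?_, ?_⟩ fun j hj => ?_).2 k
      · simpa [dotProduct_smul, h] using this
      · exact mul_nonneg (inv_nonneg.2 h.le) (hz m)
      · simp [← Finset.mul_sum, h.ne']
      · rw [dotProduct_smul, dotProduct_smul]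
        exact smul_le_smul_of_nonneg_left (hle j hj) (inv_nonneg.2 h.le)
  have hgap : ∀ j, 0 ≤ L j ⬝ᵥ q - L i ⬝ᵥ q := fun j => by
    by_cases h : j = i
    · simp [h]
    · exact (sub_pos.2 (hqlt j h)).le
  -- Adding c·B·q to y gains at least B against each neighbour other than i, which puts the sum in
  -- the cone over `C_i`; undoing the shift costs at most c·B·D. The term j = i contributes 0⁻¹ = 0.
  set c := ∑ j, (L j ⬝ᵥ q - L i ⬝ᵥ q)⁻¹ with hc
  set D := ∑ j, (L j ⬝ᵥ q - L i ⬝ᵥ q) with hD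
  have hc0 : 0 ≤ c := Finset.sum_nonneg fun j _ => inv_nonneg.2 (hgap j)
  have hD0 : 0 ≤ D := Finset.sum_nonneg fun j _ => hgap j
  refine ⟨c * D, mul_nonneg hc0 hD0, fun y B hy hB h k => ?_⟩
  have key := hcone (y + (c * B) • q)
    (fun m => add_nonneg (hy m) (mul_nonneg (mul_nonneg hc0 hB) (hq.1 m))) (fun j hj => ?_) k
  · have h1 : L k ⬝ᵥ q - L i ⬝ᵥ q ≤ D :=
      Finset.single_le_sum (f := fun j => L j ⬝ᵥ q - L i ⬝ᵥ q) (fun j _ => hgap j)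
        (Finset.mem_univ k)
    have h2 := mul_le_mul_of_nonneg_left h1 (mul_nonneg hc0 hB)
    simp only [dotProduct_add, dotProduct_smul, smul_eq_mul, sub_dotProduct] at key ⊢
    linarith
  · by_cases hji : j = i
    · rw [hji]
    have h1 : (L j ⬝ᵥ q - L i ⬝ᵥ q)⁻¹ ≤ c :=
      Finset.single_le_sum (f := fun j => (L j ⬝ᵥ q - L i ⬝ᵥ q)⁻¹)
        (fun j _ => inv_nonneg.2 (hgap j)) (Finset.mem_univ j)
    have hpos := sub_pos.2 (hqlt j hji)
    have h2 : 1 ≤ c * (L j ⬝ᵥ q - L i ⬝ᵥ q) := by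
      rwa [inv_le_iff_one_le_mul₀ hpos] at h1
    have h3 := mul_le_mul_of_nonneg_left h2 hB
    have h4 := h j hj
    simp only [dotProduct_add, dotProduct_smul, smul_eq_mul, sub_dotProduct] at h4 ⊢
    linarith

end Geometry

/-! ### The local distributions -/

section Algorithm

variable {N M : ℕ} {A : Type*}

theorem card_nbrs_pos (L : Matrix (Fin N) (Fin M) ℝ) (i : Fin N) :
    (0 : ℝ) < (nbrs L i).card := by
  exact_mod_cast Finset.card_pos.2 ⟨i, self_mem_nbrs L i⟩

theorem card_nbrs_le (L : Matrix (Fin N) (Fin M) ℝ) (i : Fin N) :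
    ((nbrs L i).card : ℝ) ≤ N := by
  exact_mod_cast (Finset.card_le_univ _).trans_eq (Fintype.card_fin N)

section LocalDist

variable (L : Matrix (Fin N) (Fin M) ℝ) (η : ℝ) {γ : ℝ} (s : State N) (i : Fin N)

theorem localDist_of_mem {j : Fin N} (hj : j ∈ nbrs L i) :
    localDist L η γ s i j =
      (1 - γ) * expWeights L η i (s.cum i) j + γ / ((nbrs L i).card : ℝ) := by
  rw [localDist, if_pos hj]

theorem localDist_of_notMem {j : Fin N} (hj : j ∉ nbrs L i) : localDist L η γ s i j = 0 := by
  rw [localDist, if_neg hj, expWeights, if_neg hj, mul_zero, add_zero]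

theorem mul_expWeights_le_localDist (h0 : 0 ≤ γ) (j : Fin N) :
    (1 - γ) * expWeights L η i (s.cum i) j ≤ localDist L η γ s i j := by
  rw [localDist, le_add_iff_nonneg_right]
  split_ifs <;> positivity

theorem localDist_nonneg (h0 : 0 ≤ γ) (h1 : γ ≤ 1) (j : Fin N) : 0 ≤ localDist L η γ s i j :=
  (mul_nonneg (sub_nonneg.2 h1) (expWeights_nonneg L η i _ j)).trans
    (mul_expWeights_le_localDist L η s i h0 j)

theorem div_card_le_localDist (h1 : γ ≤ 1) {j : Fin N} (hj : j ∈ nbrs L i) :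
    γ / ((nbrs L i).card : ℝ) ≤ localDist L η γ s i j := by
  rw [localDist_of_mem L η s i hj, le_add_iff_nonneg_left]
  exact mul_nonneg (sub_nonneg.2 h1) (expWeights_nonneg L η i _ j)

theorem sum_localDist_mul (g : Fin N → ℝ) :
    ∑ j, localDist L η γ s i j * g j = ∑ j ∈ nbrs L i, localDist L η γ s i j * g j :=
  (Finset.sum_subset (Finset.subset_univ _) fun j _ hj => by
    rw [localDist_of_notMem L η s i hj, zero_mul]).symm

theorem sum_nbrs_localDist : ∑ j ∈ nbrs L i, localDist L η γ s i j = 1 := by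
  rw [Finset.sum_congr rfl fun j hj => localDist_of_mem L η s i hj, Finset.sum_add_distrib,
    ← Finset.mul_sum, sum_expWeights, Finset.sum_const, nsmul_eq_mul,
    mul_div_cancel₀ _ (card_nbrs_pos L i).ne']
  ring

theorem sum_localDist : ∑ j, localDist L η γ s i j = 1 := by
  simpa [sum_nbrs_localDist] using sum_localDist_mul L η (γ := γ) s i 1

end LocalDist

theorem exists_stationaryRule (hN : 0 < N) (L : Matrix (Fin N) (Fin M) ℝ)
    (v : Fin N → Fin N → A ⊕ A → ℝ) (η : ℝ) {γ : ℝ} (h0 : 0 ≤ γ) (h1 : γ ≤ 1) :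
    ∃ p, StationaryRule L v η γ p := by
  have : Nonempty (Fin N) := ⟨⟨0, hN⟩⟩
  choose p hp using fun l => exists_stationary (flowMatrix L v η γ l)
    (fun i j => localDist_nonneg L η _ j h0 h1 i) (fun j => sum_localDist L η _ j)
  exact ⟨p, hp⟩

theorem abs_le_vbar [Fintype A] {L : Matrix (Fin N) (Fin M) ℝ} (v : Fin N → Fin N → A ⊕ A → ℝ)
    {i j : Fin N} (hj : j ∈ nbrs L i) (a : A ⊕ A) : |v i j a| ≤ vbar L v := by
  have h1 : ‖v i j‖ ≤ vbar L v :=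
    le_ciSup (f := fun e : {e : Fin N × Fin N // Neighbor L e.1 e.2} => ‖v e.1.1 e.1.2‖)
      (Set.finite_range _).bddAbove ⟨(i, j), mem_nbrs.1 hj⟩
  exact (norm_le_pi_norm (v i j) a).trans h1

theorem vbar_nonneg [Fintype A] (L : Matrix (Fin N) (Fin M) ℝ) (v : Fin N → Fin N → A ⊕ A → ℝ) :
    0 ≤ vbar L v :=
  Real.iSup_nonneg fun _ => norm_nonneg _

/-! ### Change of the local potential in one round -/

section Drift

variable (L : Matrix (Fin N) (Fin M) ℝ) (v : Fin N → Fin N → A ⊕ A → ℝ) (η γ : ℝ)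

theorem state_append (l : List (Obs N A)) (o : Obs N A) :
    state L v η γ (l ++ [o]) = State.update L v η γ (state L v η γ l) o := by
  simp [state]

/-- The number of rounds in which `i` was played since its local algorithm was last run. -/
def visits (i : Fin N) (l : List (Obs N A)) : ℕ :=
  l.foldl (fun G o => if o.1 = i then 0 else if o.2.1 = i then G + 1 else G) 0

theorem visits_append (i : Fin N) (l : List (Obs N A)) (o : Obs N A) :
    visits i (l ++ [o]) =
      if o.1 = i then 0 else if o.2.1 = i then visits i l + 1 else visits i l := by
  simp [visits]

variable [Fintype A]

theorem abs_estimate_le (o : Obs N A) {i h : Fin N} (hh : h ∈ nbrs L i) {q : ℝ} (hq : 0 ≤ q) :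
    |estimate L v o i h q| ≤ (if o.2.1 = i then vbar L v else 0) +
      if o.1 = i ∧ o.2.1 = h then vbar L v / q else 0 := by
  rw [estimate, if_pos hh]
  refine (abs_add_le _ _).trans (add_le_add ?_ ?_)
  · split_ifs
    · exact abs_le_vbar v hh _
    · simp
  · split_ifs
    · rw [abs_div, abs_of_nonneg hq]
      exact div_le_div_of_nonneg_right (abs_le_vbar v hh _) hq
    · simp

/-- The importance-weighted block of an estimate is nonzero only if the vertex i is drawn, and then
the accumulator is emptied at once. Only the unweighted block, present when i is played, ever waits
in it. -/
theorem abs_acc_le (hγ0 : 0 ≤ γ) (hγ1 : γ ≤ 1) {i h : Fin N} (hh : h ∈ nbrs L i)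
    (l : List (Obs N A)) : |(state L v η γ l).acc i h| ≤ vbar L v * visits i l := by
  induction l using List.reverseRecOn with
  | nil => simp [state, visits]
  | append_singleton l o ih =>
    rw [state_append, visits_append]
    simp only [State.update]
    split_ifs with h1 h2
    · simp
    · have := abs_estimate_le L v o hh (localDist_nonneg L η (state L v η γ l) i hγ0 hγ1 h)
      simp only [h1, h2, if_true, false_and, if_false, add_zero] at this
      push_cast
      linarith [abs_add_le ((state L v η γ l).acc i h)
        (estimate L v o i h (localDist L η γ (state L v η γ l) i h))]
    · have := abs_estimate_le L v o hh (localDist_nonneg L η (state L v η γ l) i hγ0 hγ1 h)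
      simp only [h1, h2, false_and, if_false, add_zero] at this
      linarith [abs_add_le ((state L v η γ l).acc i h)
        (estimate L v o i h (localDist L η γ (state L v η γ l) i h))]

/-- The negative of the estimated regret of the local algorithm of `i` against `j`, up to the
second order terms of the exponential weights bound. -/
noncomputable def localPotential (i j : Fin N) (l : List (Obs N A)) : ℝ :=
  (state L v η γ l).cum i j - ewPotential L η i ((state L v η γ l).cum i) -
    (∑ h ∈ nbrs L i, localDist L η γ (state L v η γ l) i h * (state L v η γ l).acc i h -
      (state L v η γ l).acc i j)

/-- The second order cost of running the local algorithm of `i` when `I` was played. -/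
noncomputable def runCost (i I : Fin N) (l : List (Obs N A)) : ℝ :=
  η * (8 * (vbar L v * (visits i l + 1)) ^ 2 +
      2 * expWeights L η i ((state L v η γ l).cum i) I *
        (vbar L v / localDist L η γ (state L v η γ l) i I) ^ 2) +
    γ * (2 * (vbar L v * (visits i l + 1)) +
      (((nbrs L i).card : ℝ)⁻¹ + expWeights L η i ((state L v η γ l).cum i) I) *
        (vbar L v / localDist L η γ (state L v η γ l) i I))

variable {L v η γ}

/-- If i is not drawn, the change is an identity. If i is drawn, the waiting costs enter exponential
weights, where only the coordinate of the played action carries a factor 1/q; the run pays its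
second order term and the bias of the exploration. -/
theorem localPotential_append_le (hη : 0 < η) (hγ0 : 0 < γ) (hγ1 : γ ≤ 1)
    (hηγ : η * (vbar L v * N / γ) ≤ 1 / 2) {i j : Fin N}
    (l : List (Obs N A)) (o : Obs N A) (ho : o.1 = i → o.2.1 ∈ nbrs L i) :
    localPotential L v η γ i j (l ++ [o]) +
      (∑ h ∈ nbrs L i, localDist L η γ (state L v η γ l) i h *
          estimate L v o i h (localDist L η γ (state L v η γ l) i h) -
        estimate L v o i j (localDist L η γ (state L v η γ l) i j)) ≤
      localPotential L v η γ i j l + if o.1 = i then runCost L v η γ i o.2.1 l else 0 := by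
  have hacc : ∀ h ∈ nbrs L i, |(state L v η γ l).acc i h| ≤ vbar L v * visits i l :=
    fun h hh => abs_acc_le L v η γ hγ0.le hγ1 hh l
  set s := state L v η γ l with hs
  set q := localDist L η γ s i with hq
  set b : Fin N → ℝ := fun h => estimate L v o i h (q h) with hb
  have hv := vbar_nonneg L v
  by_cases hk : o.1 = i
  · have hI := ho hk
    set I := o.2.1 with hIdef
    set x := expWeights L η i (s.cum i) with hx
    have hx0 : ∀ h, 0 ≤ x h := expWeights_nonneg L η i _
    have hx1 : ∑ h ∈ nbrs L i, x h = 1 := sum_expWeights L η i _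
    have hq0 : ∀ h, 0 ≤ q h := localDist_nonneg L η s i hγ0.le hγ1
    have hn := card_nbrs_pos L i
    have hcum : (state L v η γ (l ++ [o])).cum i = fun h => s.cum i h + (s.acc i h + b h) := by
      rw [state_append]
      ext h
      simp [State.update, hk, hb, hq, ← hs]
    have hacc' : (state L v η γ (l ++ [o])).acc i = 0 := by
      rw [state_append]
      ext h
      simp [State.update, hk]
    set a := vbar L v * ((visits i l : ℝ) + 1) with ha
    have ha0 : 0 ≤ a := by positivity
    have hqI : 0 < q I :=
      (div_pos hγ0 hn).trans_le (div_card_le_localDist L η s i hγ1 hI)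
    have hβ0 : 0 ≤ vbar L v / q I := by positivity
    -- Exploration gives q_i(I) ≥ γ/|N_i| ≥ γ/N, so the spike at I is tame at the scale of η.
    have hβ : η * (vbar L v / q I) ≤ 1 / 2 := by
      refine le_trans (mul_le_mul_of_nonneg_left ?_ hη.le) hηγ
      rw [div_le_div_iff₀ hqI hγ0]
      have h1 := div_card_le_localDist L η s i hγ1 hI
      rw [div_le_iff₀ hn] at h1
      have h2 : γ ≤ q I * N := h1.trans
        (mul_le_mul_of_nonneg_left (card_nbrs_le L i) hqI.le)
      nlinarith
    have hf : ∀ h ∈ nbrs L i, |s.acc i h + b h| ≤ a + if h = I then vbar L v / q I else 0 := by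
      intro h hh
      have h1 := abs_estimate_le L v o hh (hq0 h)
      have h2 : (if o.2.1 = i then vbar L v else 0) ≤ vbar L v := by split_ifs <;> simp [hv]
      have h3 : (if o.1 = i ∧ o.2.1 = h then vbar L v / q h else 0) =
          if h = I then vbar L v / q I else 0 := by
        by_cases hhI : h = I
        · rw [if_pos hhI, if_pos ⟨hk, hhI.symm⟩, hhI]
        · rw [if_neg hhI, if_neg fun hc => hhI hc.2.symm]
      have h4 := hacc h hh
      have h5 := abs_add_le (s.acc i h) (b h)
      rw [h3] at h1
      simp only [hb] at h5 ⊢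
      rw [ha]
      linarith
    have hew := sum_expWeights_mul_le L hη ha0 hβ hI (s.cum i) (fun h => s.acc i h + b h) hf
    have hqf : ∑ h ∈ nbrs L i, q h * (s.acc i h + b h) =
        ∑ h ∈ nbrs L i, x h * (s.acc i h + b h) +
          γ * ∑ h ∈ nbrs L i, (((nbrs L i).card : ℝ)⁻¹ - x h) * (s.acc i h + b h) := by
      rw [Finset.mul_sum, ← Finset.sum_add_distrib]
      refine Finset.sum_congr rfl fun h hh => ?_
      rw [hq, localDist_of_mem L η s i hh]
      ring
    have hmix : ∑ h ∈ nbrs L i, (((nbrs L i).card : ℝ)⁻¹ - x h) * (s.acc i h + b h) ≤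
        2 * a + (((nbrs L i).card : ℝ)⁻¹ + x I) * (vbar L v / q I) := by
      calc _ ≤ ∑ h ∈ nbrs L i, ((((nbrs L i).card : ℝ)⁻¹ + x h) * a +
            if h = I then (((nbrs L i).card : ℝ)⁻¹ + x h) * (vbar L v / q I) else 0) := by
            refine Finset.sum_le_sum fun h hh => ?_
            have h1 : |((nbrs L i).card : ℝ)⁻¹ - x h| ≤ ((nbrs L i).card : ℝ)⁻¹ + x h := by
              rw [abs_le]
              constructor <;> linarith [hx0 h, inv_pos.2 hn]
            refine (le_abs_self _).trans ?_
            rw [abs_mul]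
            refine (mul_le_mul h1 (hf h hh) (abs_nonneg _) ((abs_nonneg _).trans h1)).trans_eq ?_
            rw [mul_add, mul_ite, mul_zero]
        _ = _ := by
            rw [Finset.sum_add_distrib, ← Finset.sum_mul, Finset.sum_add_distrib, hx1,
              Finset.sum_const, nsmul_eq_mul, mul_inv_cancel₀ hn.ne', Finset.sum_ite_eq' _ _ _,
              if_pos hI]
            ring
    have hmix' := mul_le_mul_of_nonneg_left hmix hγ0.le
    have hsplit : ∑ h ∈ nbrs L i, q h * (s.acc i h + b h) =
        ∑ h ∈ nbrs L i, q h * s.acc i h + ∑ h ∈ nbrs L i, q h * b h := by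
      simp [mul_add, Finset.sum_add_distrib]
    rw [if_pos hk]
    simp only [localPotential, runCost, hcum, hacc', ← hs, ← hq, ← hx, ← ha, Pi.zero_apply,
      mul_zero, Finset.sum_const_zero]
    have e1 : (∑ h ∈ nbrs L i, q h * estimate L v o i h (q h)) =
        ∑ h ∈ nbrs L i, q h * b h := rfl
    have e2 : estimate L v o i j (q j) = b j := rfl
    rw [e1, e2]
    linarith
  · have hcum : (state L v η γ (l ++ [o])).cum i = s.cum i := by
      rw [state_append]
      ext h
      simp [State.update, hk, ← hs]
    have hacc' : (state L v η γ (l ++ [o])).acc i = fun h => s.acc i h + b h := by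
      rw [state_append]
      ext h
      simp [State.update, hk, hb, hq, ← hs]
    -- The distribution is frozen between runs, so the linear term of the potential absorbs the new
    -- estimates exactly.
    have hq' : localDist L η γ (state L v η γ (l ++ [o])) i = q := by
      ext h
      rw [localDist, hcum, hq, localDist]
    rw [if_neg hk]
    simp only [localPotential, hcum, hacc', hq', ← hs, ← hq, mul_add, Finset.sum_add_distrib]
    have e1 : (∑ h ∈ nbrs L i, q h * estimate L v o i h (q h)) =
        ∑ h ∈ nbrs L i, q h * b h := rfl
    have e2 : estimate L v o i j (q j) = b j := rfl
    rw [e1, e2]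
    linarith

/-- Averaging over the played action cancels the importance weights: γ ≤ 1/2 gives x ≤ 2q, so
q·x·(v̄/q)² ≤ 2v̄² for each of at most N neighbours. This yields the 4N; the 8 comes from the
waiting costs. -/
theorem sum_localDist_mul_runCost_le (hη : 0 < η) (hγ0 : 0 < γ) (hγ1 : γ ≤ 1 / 2) (i : Fin N)
    (l : List (Obs N A)) :
    ∑ I, localDist L η γ (state L v η γ l) i I * runCost L v η γ i I l ≤
      (η * vbar L v ^ 2 * (8 + 4 * N) + 4 * γ * vbar L v) * ((visits i l : ℝ) + 1) ^ 2 := by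
  have hv := vbar_nonneg L v
  have hn := card_nbrs_pos L i
  have hnN := card_nbrs_le L i
  have hG : (1 : ℝ) ≤ (visits i l : ℝ) + 1 := by simp
  rw [sum_localDist_mul]
  unfold runCost
  set s := state L v η γ l
  set q := localDist L η γ s i with hq
  set x := expWeights L η i (s.cum i)
  set V := vbar L v
  set g := (visits i l : ℝ) + 1
  set n := ((nbrs L i).card : ℝ) with hndef
  have hx0 : ∀ h, 0 ≤ x h := expWeights_nonneg L η i _
  have hx1 : ∑ h ∈ nbrs L i, x h = 1 := sum_expWeights L η i _
  calc _ ≤ ∑ I ∈ nbrs L i, (q I * (8 * η * (V * g) ^ 2 + 2 * γ * (V * g)) +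
        (4 * η * V ^ 2 + γ * V * (n⁻¹ + x I))) := by
        refine Finset.sum_le_sum fun I hI => ?_
        have hqI : 0 < q I :=
          (div_pos hγ0 hn).trans_le (div_card_le_localDist L η s i (by linarith) hI)
        have hxq : x I ≤ 2 * q I := by
          have := mul_expWeights_le_localDist L η s i hγ0.le I
          have h2 := hx0 I
          nlinarith
        have h3 : q I * (x I * (V / q I) ^ 2) ≤ 2 * V ^ 2 := by
          have : q I * (x I * (V / q I) ^ 2) = V ^ 2 * (x I / q I) := by field_simp
          rw [this]
          have h4 : x I / q I ≤ 2 := (div_le_iff₀ hqI).2 hxq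
          nlinarith [sq_nonneg V]
        have h5 : q I * ((n⁻¹ + x I) * (V / q I)) = V * (n⁻¹ + x I) := by field_simp
        have h6 := mul_le_mul_of_nonneg_left h3 hη.le
        have h7 : q I * (η * (8 * (V * g) ^ 2 + 2 * x I * (V / q I) ^ 2) +
            γ * (2 * (V * g) + (n⁻¹ + x I) * (V / q I))) =
            q I * (8 * η * (V * g) ^ 2 + 2 * γ * (V * g)) +
              2 * (η * (q I * (x I * (V / q I) ^ 2))) +
              γ * (q I * ((n⁻¹ + x I) * (V / q I))) := by ring
        rw [h7, h5]
        linarith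
    _ = 8 * η * (V * g) ^ 2 + 2 * γ * (V * g) + (n * (4 * η * V ^ 2) + 2 * γ * V) := by
        rw [Finset.sum_add_distrib, ← Finset.sum_mul, sum_nbrs_localDist, Finset.sum_add_distrib,
          Finset.sum_const, ← Finset.mul_sum, Finset.sum_add_distrib, hx1, Finset.sum_const,
          nsmul_eq_mul, nsmul_eq_mul, mul_inv_cancel₀ hn.ne']
        ring
    _ ≤ _ := by
        have hg2 : g ≤ g ^ 2 := by nlinarith
        have h1 : 1 ≤ g ^ 2 := by nlinarith
        have c1 : 0 ≤ η * V ^ 2 := by positivity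
        have c2 : 0 ≤ γ * V := by positivity
        have e1 := mul_le_mul_of_nonneg_left hg2 c2
        have e2 := mul_le_mul_of_nonneg_left h1 c2
        have e3 : n * (η * V ^ 2) ≤ N * (η * V ^ 2) * g ^ 2 := by
          have h8 := mul_le_mul_of_nonneg_right hnN c1
          have h9 : 0 ≤ N * (η * V ^ 2) := by positivity
          nlinarith
        nlinarith

end Drift

end Algorithm

/-! ### Conditional expectations and the drift of the compensated potential -/

section Expectation

variable {N M : ℕ} {A : Type*} [Fintype A] {L : Matrix (Fin N) (Fin M) ℝ}
  {H : Fin N → Fin M → stdSimplex ℝ A} {v : Fin N → Fin N → A ⊕ A → ℝ} {η γ : ℝ}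
  {p : List (Obs N A) → Fin N → ℝ} {opp : Opponent N M A}

theorem roundProb_nonneg (hγ0 : 0 ≤ γ) (hγ1 : γ ≤ 1) (hp : StationaryRule L v η γ p)
    (l : List (Round N M A)) (r : Round N M A) : 0 ≤ roundProb L H v η γ p opp l r :=
  mul_nonneg (mul_nonneg (mul_nonneg ((hp _).1.1 _) (localDist_nonneg L η _ _ hγ0 hγ1 _))
    ((opp l).2.1 _)) ((H _ _).2.1 _)

/-- Conditional expectation of a function of the next round. -/
theorem sum_roundProb_mul (l : List (Round N M A)) (g : Fin N → Fin N → Fin M → A → ℝ) :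
    ∑ r, roundProb L H v η γ p opp l r * g r.1 r.2.1 r.2.2.1 r.2.2.2 =
      ∑ k, p (l.map Round.obs) k *
        ∑ I, localDist L η γ (state L v η γ (l.map Round.obs)) k I *
          ∑ m, (opp l : Fin M → ℝ) m * ∑ σ, (H I m : A → ℝ) σ * g k I m σ := by
  simp only [Fintype.sum_prod_type, roundProb, flowMatrix, Matrix.of_apply, Finset.mul_sum,
    mul_assoc]

/-- The played action has distribution `p`, by stationarity. -/
theorem sum_roundProb_mul_played (hp : StationaryRule L v η γ p) (l : List (Round N M A))
    (g : Fin N → Fin M → A → ℝ) :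
    ∑ r, roundProb L H v η γ p opp l r * g r.2.1 r.2.2.1 r.2.2.2 =
      ∑ I, p (l.map Round.obs) I *
        ∑ m, (opp l : Fin M → ℝ) m * ∑ σ, (H I m : A → ℝ) σ * g I m σ := by
  rw [sum_roundProb_mul l fun _ => g]
  simp only [Finset.mul_sum (s := Finset.univ (α := Fin N)), ← mul_assoc]
  rw [Finset.sum_comm]
  refine Finset.sum_congr rfl fun I _ => ?_
  rw [← Finset.sum_mul]
  congr 1
  conv_rhs => rw [(hp (l.map Round.obs)).2]
  simp only [Matrix.mulVec, dotProduct, flowMatrix, Matrix.of_apply]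
  exact Finset.sum_congr rfl fun k _ => mul_comm _ _

theorem sum_roundProb_mul_drawn (l : List (Round N M A)) (i : Fin N)
    (g : Fin N → Fin M → A → ℝ) :
    ∑ r, roundProb L H v η γ p opp l r * (if r.1 = i then g r.2.1 r.2.2.1 r.2.2.2 else 0) =
      p (l.map Round.obs) i *
        ∑ I, localDist L η γ (state L v η γ (l.map Round.obs)) i I *
          ∑ m, (opp l : Fin M → ℝ) m * ∑ σ, (H I m : A → ℝ) σ * g I m σ := by
  rw [sum_roundProb_mul l fun k I m σ => if k = i then g I m σ else 0,
    Finset.sum_eq_single_of_mem i (Finset.mem_univ i)]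
  · simp
  · intro k _ hk
    simp [hk]

theorem sum_signal (I : Fin N) (m : Fin M) (c : ℝ) : ∑ σ, (H I m : A → ℝ) σ * c = c := by
  have h : ∑ σ, (H I m : A → ℝ) σ = 1 := (H I m).2.2
  rw [← Finset.sum_mul, h, one_mul]

theorem sum_opponent {A : Type*} {opp : Opponent N M A} (l : List (Round N M A)) (c : ℝ) :
    ∑ m, (opp l : Fin M → ℝ) m * c = c := by
  have h : ∑ m, (opp l : Fin M → ℝ) m = 1 := (opp l).2.2
  rw [← Finset.sum_mul, h, one_mul]

theorem sum_roundProb (hp : StationaryRule L v η γ p) (l : List (Round N M A)) :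
    ∑ r, roundProb L H v η γ p opp l r = 1 := by
  have := sum_roundProb_mul_played (H := H) (opp := opp) hp l fun _ _ _ => 1
  simp only [sum_signal, sum_opponent] at this
  simpa [(hp _).1.2] using this

theorem DifferenceVectors.sub_apply (hv : DifferenceVectors L H v) {i h : Fin N}
    (hh : h ∈ nbrs L i) (m : Fin M) :
    L h m - L i m = ∑ σ, (H i m : A → ℝ) σ * v i h (Sum.inl σ) +
      ∑ σ, (H h m : A → ℝ) σ * v i h (Sum.inr σ) := by
  have := congrFun (hv i h (mem_nbrs.1 hh)) m
  simpa [Matrix.mulVec, dotProduct, stackedMatrix, Fintype.sum_sum_type, signalMatrix] using this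

/-- The estimates are unbiased. -/
theorem sum_roundProb_mul_estimate (hp : StationaryRule L v η γ p)
    (hv : DifferenceVectors L H v) (hγ0 : 0 < γ) (hγ1 : γ ≤ 1) {i h : Fin N}
    (hh : h ∈ nbrs L i) (l : List (Round N M A)) :
    ∑ r, roundProb L H v η γ p opp l r * estimate L v r.obs i h
        (localDist L η γ (state L v η γ (l.map Round.obs)) i h) =
      p (l.map Round.obs) i * ∑ m, (opp l : Fin M → ℝ) m * (L h m - L i m) := by
  set q := localDist L η γ (state L v η γ (l.map Round.obs)) i h with hq
  have hq0 : 0 < q := (div_pos hγ0 (card_nbrs_pos L i)).trans_le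
    (div_card_le_localDist L η _ i hγ1 hh)
  have h1 : ∀ r : Round N M A, estimate L v r.obs i h q =
      (if r.2.1 = i then v i h (Sum.inl r.2.2.2) else 0) +
        if r.1 = i then (if r.2.1 = h then v i h (Sum.inr r.2.2.2) / q else 0) else 0 := by
    intro r
    rw [estimate, if_pos hh, ite_and]
    rfl
  -- The first block occurs when i is played, with probability p_i by stationarity. The second
  -- occurs when i is drawn and h played, with probability p_i q, and the q cancels. The common
  -- factor p_i lets the blocks combine to ℓ_h - ℓ_i.
  have e1 := sum_roundProb_mul_played (H := H) (opp := opp) hp l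
    fun I _ σ => if I = i then v i h (Sum.inl σ) else 0
  have e2 := sum_roundProb_mul_drawn (H := H) (opp := opp) (p := p) (v := v) (L := L) (η := η)
    (γ := γ) l i fun I _ σ => if I = h then v i h (Sum.inr σ) / q else 0
  simp only [h1, mul_add, Finset.sum_add_distrib, e1, e2]
  rw [Finset.sum_eq_single_of_mem i (Finset.mem_univ i) fun k _ hk => by simp [hk],
    Finset.sum_eq_single_of_mem h (Finset.mem_univ h) fun k _ hk => by simp [hk], ← hq]
  simp only [if_true, hv.sub_apply hh, mul_add, Finset.sum_add_distrib]
  congr 2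
  rw [Finset.mul_sum]
  refine Finset.sum_congr rfl fun m _ => ?_
  simp only [mul_div_assoc', ← Finset.sum_div]
  field_simp

/-- The expected loss, in the next round, of the local distribution of `i` against that of `j`,
weighted by the probability of `i`. -/
noncomputable def localRegret (L : Matrix (Fin N) (Fin M) ℝ) (v : Fin N → Fin N → A ⊕ A → ℝ)
    (η γ : ℝ) (p : List (Obs N A) → Fin N → ℝ) (opp : Opponent N M A) (i j : Fin N)
    (l : List (Round N M A)) : ℝ :=
  p (l.map Round.obs) i * ∑ m, (opp l : Fin M → ℝ) m *
    (∑ h, localDist L η γ (state L v η γ (l.map Round.obs)) i h * L h m - L j m)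

theorem sum_roundProb_mul_regret_estimate (hp : StationaryRule L v η γ p)
    (hv : DifferenceVectors L H v) (hγ0 : 0 < γ) (hγ1 : γ ≤ 1) {i j : Fin N}
    (hj : j ∈ nbrs L i) (l : List (Round N M A)) :
    ∑ r, roundProb L H v η γ p opp l r *
      (∑ h ∈ nbrs L i, localDist L η γ (state L v η γ (l.map Round.obs)) i h *
          estimate L v r.obs i h (localDist L η γ (state L v η γ (l.map Round.obs)) i h) -
        estimate L v r.obs i j (localDist L η γ (state L v η γ (l.map Round.obs)) i j)) =
      localRegret L v η γ p opp i j l := by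
  have hE := fun h (hh : h ∈ nbrs L i) =>
    sum_roundProb_mul_estimate (opp := opp) hp hv hγ0 hγ1 hh l
  simp only [mul_sub, Finset.sum_sub_distrib, Finset.mul_sum]
  rw [Finset.sum_comm, hE j hj]
  have h2 : ∀ h ∈ nbrs L i, ∑ r, roundProb L H v η γ p opp l r *
      (localDist L η γ (state L v η γ (l.map Round.obs)) i h *
        estimate L v r.obs i h (localDist L η γ (state L v η γ (l.map Round.obs)) i h)) =
      p (l.map Round.obs) i * ∑ m, (opp l : Fin M → ℝ) m *
        (localDist L η γ (state L v η γ (l.map Round.obs)) i h * (L h m - L i m)) := by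
    intro h hh
    simp only [mul_left_comm _ (localDist L η γ (state L v η γ (l.map Round.obs)) i h),
      ← Finset.mul_sum]
    rw [hE h hh]
  rw [Finset.sum_congr rfl h2, ← Finset.mul_sum, Finset.sum_comm, ← mul_sub,
    ← Finset.sum_sub_distrib, localRegret]
  congr 1
  refine Finset.sum_congr rfl fun m _ => ?_
  rw [← Finset.mul_sum, ← mul_sub, sum_localDist_mul]
  congr 1
  -- The baseline ℓ_i in the estimates drops out because q_i has total mass one on N_i.
  simp only [mul_sub, Finset.sum_sub_distrib, ← Finset.sum_mul, sum_nbrs_localDist]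
  ring

/-- The compensated potential decreases by the local regret, up to a constant. -/
theorem localRegret_drift (hp : StationaryRule L v η γ p) (hv : DifferenceVectors L H v)
    (hη : 0 < η) (hγ0 : 0 < γ) (hγ1 : γ ≤ 1 / 2) (hηγ : η * (vbar L v * N / γ) ≤ 1 / 2)
    {i j : Fin N} (hj : j ∈ nbrs L i) {K : ℝ}
    (hK : K = η * vbar L v ^ 2 * (8 + 4 * N) + 4 * γ * vbar L v) (l : List (Round N M A)) :
    localRegret L v η γ p opp i j l + ∑ r, roundProb L H v η γ p opp l r *
        (localPotential L v η γ i j ((l ++ [r]).map Round.obs) +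
          K * (2 * (visits i ((l ++ [r]).map Round.obs) : ℝ) ^ 2)) ≤
      localPotential L v η γ i j (l.map Round.obs) +
        K * (2 * (visits i (l.map Round.obs) : ℝ) ^ 2) + 12 * K := by
  have hγ1' : γ ≤ 1 := by linarith
  have hV := vbar_nonneg L v
  have hK0 : 0 ≤ K := by rw [hK]; positivity
  rw [← sum_roundProb_mul_regret_estimate (H := H) hp hv hγ0 hγ1' hj l,
    ← Finset.sum_add_distrib]
  set o := l.map Round.obs with ho
  set G : ℝ := (visits i o : ℝ) with hG
  have hpi0 : 0 ≤ p o i := (hp o).1.1 i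
  have hpi1 : p o i ≤ 1 := by
    rw [← (hp o).1.2]
    exact Finset.single_le_sum (fun k _ => (hp o).1.1 k) (Finset.mem_univ i)
  have hG0 : 0 ≤ G := Nat.cast_nonneg _
  calc _ ≤ ∑ r, (roundProb L H v η γ p opp l r *
          (localPotential L v η γ i j o + K * (2 * G ^ 2)) +
        (roundProb L H v η γ p opp l r *
            (if r.1 = i then runCost L v η γ i r.2.1 o - K * (2 * G ^ 2) else 0) +
          roundProb L H v η γ p opp l r * (if r.2.1 = i then K * (4 * G + 2) else 0))) := by
        refine Finset.sum_le_sum fun r _ => ?_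
        rw [← mul_add, ← mul_add, ← mul_add]
        have hw := roundProb_nonneg (H := H) (opp := opp) hγ0.le hγ1' hp l r
        by_cases hr : r.1 = i → r.2.1 ∈ nbrs L i
        · refine mul_le_mul_of_nonneg_left ?_ hw
          have h1 := localPotential_append_le hη hγ0 hγ1' hηγ (j := j) o r.obs hr
          -- The increment 2(G+1)² - 2G² = 4G + 2 is charged whenever i is played, even if a draw of
          -- i resets the counter in the same round; this only weakens the bound.
          have h2 : K * (2 * (visits i (o ++ [r.obs]) : ℝ) ^ 2) ≤ K * (2 * G ^ 2) +
              ((if r.1 = i then -(K * (2 * G ^ 2)) else 0) +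
                if r.2.1 = i then K * (4 * G + 2) else 0) := by
            have e1 : r.obs.1 = r.1 := rfl
            have e2 : r.obs.2.1 = r.2.1 := rfl
            have h3 : 0 ≤ K * (4 * G + 2) := by positivity
            rw [visits_append, e1, e2]
            split_ifs
            · simpa using h3
            · simp
            · push_cast
              rw [← hG]
              linarith
            · rw [← hG]
              linarith
          have e1 : r.obs.1 = r.1 := rfl
          have e2 : r.obs.2.1 = r.2.1 := rfl
          rw [e1, e2] at h1
          rw [List.map_append, List.map_singleton, ← ho]
          have h4 : (if r.1 = i then runCost L v η γ i r.2.1 o - K * (2 * G ^ 2) else 0) =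
              (if r.1 = i then runCost L v η γ i r.2.1 o else 0) +
                if r.1 = i then -(K * (2 * G ^ 2)) else 0 := by
            split_ifs <;> ring
          rw [h4]
          linarith
        -- Drawing i and then playing outside N_i has probability zero.
        · push Not at hr
          have : roundProb L H v η γ p opp l r = 0 := by
            have h0 : flowMatrix L v η γ (l.map Round.obs) r.2.1 r.1 = 0 := by
              rw [flowMatrix, Matrix.of_apply, hr.1]
              exact localDist_of_notMem L η _ i hr.2
            rw [roundProb, h0]
            ring
          simp [this]
    _ = localPotential L v η γ i j o + K * (2 * G ^ 2) +
        p o i * (∑ I, localDist L η γ (state L v η γ o) i I * runCost L v η γ i I o -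
          K * (2 * G ^ 2) + K * (4 * G + 2)) := by
        -- The events "i is drawn" and "i is played" both receive weight p_i, the latter by
        -- stationarity; this is what lets the reset pay for the growth of G.
        rw [Finset.sum_add_distrib, Finset.sum_add_distrib, ← Finset.sum_mul, sum_roundProb hp,
          sum_roundProb_mul_drawn l i fun I _ _ => runCost L v η γ i I o - K * (2 * G ^ 2),
          sum_roundProb_mul_played hp l fun I _ _ => if I = i then K * (4 * G + 2) else 0]
        simp only [sum_signal, sum_opponent]
        simp only [mul_ite, mul_zero, Finset.sum_ite_eq', Finset.mem_univ, if_true, mul_sub,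
          Finset.sum_sub_distrib, ← Finset.sum_mul]
        rw [← ho, sum_localDist]
        ring
    _ ≤ _ := by
        have h1 := sum_localDist_mul_runCost_le (v := v) (L := L) hη hγ0 hγ1 i o
        rw [← hK, ← hG] at h1
        have h2 : ∑ I, localDist L η γ (state L v η γ o) i I * runCost L v η γ i I o -
            K * (2 * G ^ 2) + K * (4 * G + 2) ≤ 12 * K := by
          -- (G+1)² - 2G² + 4G + 2 = 12 - (G-3)².
          nlinarith [mul_nonneg hK0 (sq_nonneg (G - 3))]
        have h3 := mul_le_mul_of_nonneg_left h2 hpi0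
        have h4 : p o i * (12 * K) ≤ 12 * K := by nlinarith
        linarith

/-- The cumulative expected regret of every local algorithm. -/
theorem sum_pathExp_localRegret_le (hp : StationaryRule L v η γ p) (hv : DifferenceVectors L H v)
    (hη : 0 < η) (hγ0 : 0 < γ) (hγ1 : γ ≤ 1 / 2) (hηγ : η * (vbar L v * N / γ) ≤ 1 / 2)
    {i j : Fin N} (hj : j ∈ nbrs L i) {K : ℝ} (hK0 : 0 < K)
    (hK : K = η * vbar L v ^ 2 * (8 + 4 * N) + 4 * γ * vbar L v) (T : ℕ) :
    ∑ t ∈ Finset.range T, pathExp (roundProb L H v η γ p opp) t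
        (localRegret L v η γ p opp i j) ≤
      12 * K * T + Real.log N / η + vbar L v ^ 2 / (2 * K) := by
  have hγ1' : γ ≤ 1 := by linarith
  have hdrift := sum_pathExp_le_of_drift (w := roundProb L H v η γ p opp)
    (roundProb_nonneg hγ0.le hγ1' hp) (sum_roundProb hp)
    (V := fun l => localPotential L v η γ i j (l.map Round.obs) +
      K * (2 * (visits i (l.map Round.obs) : ℝ) ^ 2))
    (localRegret_drift hp hv hη hγ0 hγ1 hηγ hj hK) T
  have hV0 : localPotential L v η γ i j (([] : List (Round N M A)).map Round.obs) +
      K * (2 * (visits i (([] : List (Round N M A)).map Round.obs) : ℝ) ^ 2) ≤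
        Real.log N / η := by
    have := neg_ewPotential_zero_le L hη i
    simpa [localPotential, state, visits, Pi.zero_def] using this
  have hVT : -(vbar L v ^ 2 / (2 * K)) ≤ pathExp (roundProb L H v η γ p opp) T fun l =>
      localPotential L v η γ i j (l.map Round.obs) +
        K * (2 * (visits i (l.map Round.obs) : ℝ) ^ 2) := by
    rw [← pathExp_const (sum_roundProb (H := H) (opp := opp) hp) T (-(vbar L v ^ 2 / (2 * K)))]
    refine pathExp_mono (roundProb_nonneg hγ0.le hγ1' hp) T fun l => ?_
    set o := l.map Round.obs
    set s := state L v η γ o with hs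
    have hacc : ∀ h ∈ nbrs L i, |s.acc i h| ≤ vbar L v * visits i o :=
      fun h hh => abs_acc_le L v η γ hγ0.le hγ1' hh o
    have h1 := ewPotential_le L hη hj (s.cum i)
    have h2 : ∑ h ∈ nbrs L i, localDist L η γ s i h * s.acc i h ≤ vbar L v * visits i o := by
      calc _ ≤ ∑ h ∈ nbrs L i, localDist L η γ s i h * (vbar L v * visits i o) :=
            Finset.sum_le_sum fun h hh => mul_le_mul_of_nonneg_left
              ((le_abs_self _).trans (hacc h hh)) (localDist_nonneg L η s i hγ0.le hγ1' h)
        _ = _ := by rw [← Finset.sum_mul, sum_nbrs_localDist, one_mul]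
    have h3 := (abs_le.1 (hacc j hj)).1
    -- Costs still waiting at the horizon make the potential negative by at most 2v̄G; the
    -- compensator absorbs this by completing the square.
    have h4 : 2 * (vbar L v * visits i o) ≤
        K * (2 * (visits i o : ℝ) ^ 2) + vbar L v ^ 2 / (2 * K) := by
      have : K * (2 * (visits i o : ℝ) ^ 2) + vbar L v ^ 2 / (2 * K) -
          2 * (vbar L v * visits i o) = (2 * K * visits i o - vbar L v) ^ 2 / (2 * K) := by
        field_simp
        ring
      have h5 : 0 ≤ (2 * K * visits i o - vbar L v) ^ 2 / (2 * K) := by positivity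
      linarith
    simp only [localPotential, ← hs]
    linarith
  linarith

end Expectation

/-! ### From local regret to the regret of the player -/

section Regret

variable {N M : ℕ} {A : Type*} [Fintype A] {L : Matrix (Fin N) (Fin M) ℝ}
  {H : Fin N → Fin M → stdSimplex ℝ A} {v : Fin N → Fin N → A ⊕ A → ℝ} {η γ : ℝ}
  {p : List (Obs N A) → Fin N → ℝ} {opp : Opponent N M A}

theorem LocallyObservable.exists_differenceVectors (h : LocallyObservable L H) :
    ∃ v, DifferenceVectors L H v := by
  have h' : ∀ i j, ∃ v, Neighbor L i j →
      L j - L i = Matrix.mulVec (stackedMatrix H i j).transpose v := by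
    intro i j
    by_cases hij : Neighbor L i j
    · obtain ⟨w, hw⟩ := h i j hij
      refine ⟨-w, fun _ => ?_⟩
      rw [Matrix.mulVec_neg, ← Matrix.mulVecLin_apply, hw, neg_sub]
    · exact ⟨0, fun h => absurd h hij⟩
  choose v hv using h'
  exact ⟨v, hv⟩

/-- The expected regret, in the next round, with respect to the departure function `φ`. -/
noncomputable def regretRate (L : Matrix (Fin N) (Fin M) ℝ) (p : List (Obs N A) → Fin N → ℝ)
    (opp : Opponent N M A) (φ : Fin N → Fin N) (l : List (Round N M A)) : ℝ :=
  ∑ i, p (l.map Round.obs) i * ∑ m, (opp l : Fin M → ℝ) m * (L i m - L (φ i) m)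

theorem expectedRegret_eq_sum_regretRate (hp : StationaryRule L v η γ p) (T : ℕ)
    (φ : Fin N → Fin N) :
    expectedRegret L H v η γ p opp T φ =
      ∑ t ∈ Finset.range T, pathExp (roundProb L H v η γ p opp) t (regretRate L p opp φ) := by
  have h1 := pathExp_list_sum (w := roundProb L H v η γ p opp) (sum_roundProb hp) T
    fun r => L r.2.1 r.2.2.1 - L (φ r.2.1) r.2.2.1
  have h2 : expectedRegret L H v η γ p opp T φ = pathExp (roundProb L H v η γ p opp) T
      fun l => (l.map fun r => L r.2.1 r.2.2.1 - L (φ r.2.1) r.2.2.1).sum := by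
    simp only [expectedRegret, pathExp, playProb, List.map_ofFn, List.sum_ofFn,
      Function.comp_apply]
  rw [h2, h1]
  refine Finset.sum_congr rfl fun t _ => ?_
  congr 1
  ext l
  rw [sum_roundProb_mul_played hp l fun I m _ => L I m - L (φ I) m]
  simp only [sum_signal, regretRate]

/-- The expected time during which the player plays `i` and the opponent plays `m`. -/
noncomputable def occupation (w : List (Round N M A) → Round N M A → ℝ)
    (p : List (Obs N A) → Fin N → ℝ) (opp : Opponent N M A) (T : ℕ) (i : Fin N) (m : Fin M) : ℝ :=
  ∑ t ∈ Finset.range T, pathExp w t fun l =>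
    p (l.map Round.obs) i * (opp l : Fin M → ℝ) m

/-- The regret is linear in the occupation measures and separates over the played action, so each
action can be treated alone by the geometric bound. -/
theorem expectedRegret_eq_sum_occupation (hp : StationaryRule L v η γ p) (T : ℕ)
    (φ : Fin N → Fin N) :
    expectedRegret L H v η γ p opp T φ =
      ∑ i, (L i - L (φ i)) ⬝ᵥ occupation (roundProb L H v η γ p opp) p opp T i := by
  rw [expectedRegret_eq_sum_regretRate hp]
  simp only [dotProduct, occupation, Finset.mul_sum, ← pathExp_mul_left]
  simp only [Finset.sum_comm (s := Finset.univ) (t := Finset.range T), ← pathExp_sum]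
  refine Finset.sum_congr rfl fun t _ => ?_
  congr 1
  ext l
  refine Finset.sum_congr rfl fun i _ => ?_
  rw [Finset.mul_sum]
  refine Finset.sum_congr rfl fun m _ => ?_
  rw [Pi.sub_apply]
  ring

theorem occupation_nonneg (hγ0 : 0 ≤ γ) (hγ1 : γ ≤ 1) (hp : StationaryRule L v η γ p) (T : ℕ)
    (i : Fin N) (m : Fin M) : 0 ≤ occupation (roundProb L H v η γ p opp) p opp T i m :=
  Finset.sum_nonneg fun _ _ => pathExp_nonneg (roundProb_nonneg hγ0 hγ1 hp) _ fun _ =>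
    mul_nonneg ((hp _).1.1 _) ((opp _).2.1 _)

/-- The regrets of the local algorithms add up to the regret of the player. -/
theorem regretRate_eq_sum_localRegret {A : Type*} {v : Fin N → Fin N → A ⊕ A → ℝ}
    {p : List (Obs N A) → Fin N → ℝ} {opp : Opponent N M A} (hp : StationaryRule L v η γ p) (φ : Fin N → Fin N)
    (l : List (Round N M A)) :
    regretRate L p opp φ l = ∑ i, localRegret L v η γ p opp i (φ i) l := by
  have hflow : ∀ m, ∑ i, p (l.map Round.obs) i * L i m =
      ∑ i, p (l.map Round.obs) i *
        ∑ h, localDist L η γ (state L v η γ (l.map Round.obs)) i h * L h m := by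
    intro m
    simp only [Finset.mul_sum]
    rw [Finset.sum_comm]
    refine Finset.sum_congr rfl fun h _ => ?_
    conv_lhs => rw [(hp (l.map Round.obs)).2]
    simp only [Matrix.mulVec, dotProduct, flowMatrix, Matrix.of_apply, Finset.sum_mul]
    exact Finset.sum_congr rfl fun k _ => by ring
  simp only [regretRate, localRegret, Finset.mul_sum (s := Finset.univ (α := Fin M))]
  rw [Finset.sum_comm, Finset.sum_comm (s := Finset.univ (α := Fin N))]
  refine Finset.sum_congr rfl fun m _ => ?_
  simp only [mul_left_comm _ ((opp l : Fin M → ℝ) m), ← Finset.mul_sum]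
  congr 1
  simp only [mul_sub, Finset.sum_sub_distrib, hflow m]

theorem expectedRegret_le_of_localRegret_le (hp : StationaryRule L v η γ p) {T : ℕ} {B : ℝ}
    (φ : Fin N → Fin N)
    (h : ∀ i, ∑ t ∈ Finset.range T, pathExp (roundProb L H v η γ p opp) t
      (localRegret L v η γ p opp i (φ i)) ≤ B) :
    expectedRegret L H v η γ p opp T φ ≤ N * B := by
  have h1 : regretRate L p opp φ = fun l => ∑ i, localRegret L v η γ p opp i (φ i) l :=
    funext (regretRate_eq_sum_localRegret hp φ)
  rw [expectedRegret_eq_sum_regretRate hp, h1]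
  simp only [pathExp_sum]
  rw [Finset.sum_comm]
  calc _ ≤ ∑ _i : Fin N, B := Finset.sum_le_sum fun i _ => h i
    _ = _ := by simp

theorem expectedRegret_update (hp : StationaryRule L v η γ p) (T : ℕ) (i j : Fin N) :
    expectedRegret L H v η γ p opp T (Function.update id i j) =
      (L i - L j) ⬝ᵥ occupation (roundProb L H v η γ p opp) p opp T i := by
  rw [expectedRegret_eq_sum_occupation hp, Finset.sum_eq_single_of_mem i (Finset.mem_univ i)]
  · simp
  · intro k _ hk
    simp [hk]

/-- The diameter-like constant that trivially bounds the loss differences. -/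
noncomputable def lossRange (L : Matrix (Fin N) (Fin M) ℝ) : ℝ :=
  ∑ i, ∑ j, ∑ m, |L i m - L j m|

theorem sub_le_lossRange (L : Matrix (Fin N) (Fin M) ℝ) (i j : Fin N) (m : Fin M) :
    L i m - L j m ≤ lossRange L := by
  have h1 := Finset.single_le_sum (f := fun m => |L i m - L j m|) (fun _ _ => abs_nonneg _)
    (Finset.mem_univ m)
  have h2 := Finset.single_le_sum (f := fun j => ∑ m, |L i m - L j m|)
    (fun _ _ => Finset.sum_nonneg fun _ _ => abs_nonneg _) (Finset.mem_univ j)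
  have h3 := Finset.single_le_sum (f := fun i => ∑ j, ∑ m, |L i m - L j m|)
    (fun _ _ => Finset.sum_nonneg fun _ _ => Finset.sum_nonneg fun _ _ => abs_nonneg _)
    (Finset.mem_univ i)
  exact (le_abs_self _).trans (h1.trans (h2.trans h3))

theorem lossRange_nonneg (L : Matrix (Fin N) (Fin M) ℝ) : 0 ≤ lossRange L :=
  Finset.sum_nonneg fun _ _ => Finset.sum_nonneg fun _ _ => Finset.sum_nonneg fun _ _ =>
    abs_nonneg _

theorem expectedRegret_le_lossRange (hγ0 : 0 ≤ γ) (hγ1 : γ ≤ 1) (hp : StationaryRule L v η γ p)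
    (T : ℕ) (φ : Fin N → Fin N) :
    expectedRegret L H v η γ p opp T φ ≤ lossRange L * T := by
  rw [expectedRegret_eq_sum_regretRate hp]
  calc _ ≤ ∑ t ∈ Finset.range T,
        pathExp (roundProb L H v η γ p opp) t fun _ => lossRange L := by
        refine Finset.sum_le_sum fun t _ => pathExp_mono (roundProb_nonneg hγ0 hγ1 hp) t fun l => ?_
        calc regretRate L p opp φ l ≤ ∑ i, p (l.map Round.obs) i *
              ∑ m, (opp l : Fin M → ℝ) m * lossRange L :=
              Finset.sum_le_sum fun i _ => mul_le_mul_of_nonneg_left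
                (Finset.sum_le_sum fun m _ => mul_le_mul_of_nonneg_left
                  (sub_le_lossRange L _ _ m) ((opp l).2.1 m)) ((hp _).1.1 i)
          _ = lossRange L := by
            simp only [sum_opponent]
            rw [← Finset.sum_mul, (hp _).1.2, one_mul]
    _ = _ := by
        simp only [pathExp_const (sum_roundProb hp), Finset.sum_const, Finset.card_range,
          nsmul_eq_mul]
        ring

/-- It suffices to bound the regret of departures from an action to its neighbours. -/
theorem Nondegenerate.exists_expectedRegret_le (hL : Nondegenerate L) :
    ∃ K : ℝ, 0 ≤ K ∧ ∀ (H : Fin N → Fin M → stdSimplex ℝ A) (v : Fin N → Fin N → A ⊕ A → ℝ)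
      (η γ : ℝ), 0 ≤ γ → γ ≤ 1 → ∀ p, StationaryRule L v η γ p → ∀ (opp : Opponent N M A) (T : ℕ)
      (B : ℝ), 0 ≤ B →
      (∀ i, ∀ j ∈ nbrs L i,
        expectedRegret L H v η γ p opp T (Function.update id i j) ≤ B) →
      ∀ φ, expectedRegret L H v η γ p opp T φ ≤ K * B := by
  choose K hK0 hK using hL.exists_regret_le
  refine ⟨∑ i, K i, Finset.sum_nonneg fun i _ => hK0 i, ?_⟩
  intro H v η γ hγ0 hγ1 p hp opp T B hB h φ
  rw [expectedRegret_eq_sum_occupation hp, Finset.sum_mul]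
  refine Finset.sum_le_sum fun i _ => hK i _ B (occupation_nonneg hγ0 hγ1 hp T i) hB
    (fun j hj => ?_) (φ i)
  rw [← expectedRegret_update hp]
  exact h i j hj

theorem expectedRegret_update_le (hp : StationaryRule L v η γ p) (hv : DifferenceVectors L H v)
    (hη : 0 < η) (hγ0 : 0 < γ) (hγ1 : γ ≤ 1 / 2) (hηγ : η * (vbar L v * N / γ) ≤ 1 / 2)
    {i j : Fin N} (hj : j ∈ nbrs L i) {K : ℝ} (hK0 : 0 < K)
    (hK : K = η * vbar L v ^ 2 * (8 + 4 * N) + 4 * γ * vbar L v) (T : ℕ) :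
    expectedRegret L H v η γ p opp T (Function.update id i j) ≤
      N * (12 * K * T + Real.log N / η + vbar L v ^ 2 / (2 * K)) := by
  refine expectedRegret_le_of_localRegret_le hp _ fun k => ?_
  refine sum_pathExp_localRegret_le hp hv hη hγ0 hγ1 hηγ ?_ hK0 hK T
  -- The flow identity involves every local algorithm, even for a departure from i alone. For k ≠ i
  -- the comparator is k, which belongs to N_k by convention.
  by_cases hk : k = i
  · subst hk
    simpa using hj
  · simpa [hk] using self_mem_nbrs L k

theorem DifferenceVectors.eq_of_vbar_eq_zero (hv : DifferenceVectors L H v)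
    (h0 : vbar L v = 0) {i j : Fin N} (hj : j ∈ nbrs L i) : L i = L j := by
  have h : v i j = 0 := by
    ext a
    have := abs_le_vbar v hj a
    rw [h0] at this
    exact abs_nonpos_iff.1 this
  have h1 := hv i j (mem_nbrs.1 hj)
  rw [h, Matrix.mulVec_zero] at h1
  exact (sub_eq_zero.1 h1).symm

/-- The regret bound at the tuned parameters, for departures to neighbours. -/
theorem expectedRegret_update_le_sqrt (hN : 2 ≤ N) (hv : DifferenceVectors L H v)
    (hV : 0 < vbar L v) {κ : ℝ} (hκ0 : 0 < κ)
    (hκ : 2 * Real.sqrt (Real.log N / 24) * N ≤ κ) {T : ℕ} (hT : 1 ≤ T)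
    (hη : η = Real.sqrt (Real.log N / (24 * vbar L v ^ 2 * T))) (hγ : γ = κ / Real.sqrt T)
    (hγ1 : γ ≤ 1 / 2) (hp : StationaryRule L v η γ p) {i j : Fin N} (hj : j ∈ nbrs L i) {k : ℝ}
    (hk : k = vbar L v * Real.sqrt (Real.log N / 24) * (8 + 4 * N) + 4 * κ * vbar L v) :
    expectedRegret L H v η γ p opp T (Function.update id i j) ≤
      N * (12 * k + Real.log N * vbar L v / Real.sqrt (Real.log N / 24) +
        vbar L v ^ 2 / (2 * k)) * Real.sqrt T := by
  have hlog : 0 < Real.log N := Real.log_pos (by exact_mod_cast hN)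
  have hT0 : (0 : ℝ) < T := by exact_mod_cast hT
  have hs : 0 < Real.sqrt T := Real.sqrt_pos.2 hT0
  have hsT : Real.sqrt T * Real.sqrt T = T := Real.mul_self_sqrt hT0.le
  set lam := Real.sqrt (Real.log N / 24) with hlam
  have hlam0 : 0 < lam := Real.sqrt_pos.2 (by positivity)
  set V := vbar L v with hVdef
  have hη' : η = lam / (V * Real.sqrt T) := by
    have : Real.log N / (24 * V ^ 2 * T) = Real.log N / 24 / (V ^ 2 * T) := by
      field_simp
    rw [hη, this, Real.sqrt_div (by positivity), Real.sqrt_mul (by positivity),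
      Real.sqrt_sq hV.le]
  have hη0 : 0 < η := by rw [hη']; positivity
  have hγ0 : 0 < γ := by rw [hγ]; positivity
  have hk0 : 0 < k := by rw [hk]; positivity
  -- V and √T cancel, so this is a condition on κ alone.
  have hηγ : η * (V * N / γ) ≤ 1 / 2 := by
    have : η * (V * N / γ) = lam * N / κ := by
      rw [hη', hγ]
      field_simp
    rw [this, div_le_iff₀ hκ0]
    linarith
  have hK : k / Real.sqrt T = η * V ^ 2 * (8 + 4 * N) + 4 * γ * V := by
    rw [hη', hγ, hk]
    field_simp
  refine (expectedRegret_update_le hp hv hη0 hγ0 hγ1 hηγ hj (by positivity) hK T).trans_eq ?_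
  have h12 : 12 * (k / Real.sqrt T) * T = 12 * k * Real.sqrt T := by
    nth_rewrite 2 [← hsT]
    field_simp
  rw [h12, hη', ← hVdef]
  field_simp

end Regret

end PartialMonitoring

/-! ### Choice of constants and conclusion -/

theorem mainTheorem4 {N M : ℕ} {A : Type*} [Fintype A] (hN : 0 < N)
    (L : Matrix (Fin N) (Fin M) ℝ) (H : Fin N → Fin M → stdSimplex ℝ A)
    (hL : PartialMonitoring.Nondegenerate L)
    (hLH : PartialMonitoring.LocallyObservable L H) :
    (∃ v, PartialMonitoring.DifferenceVectors L H v) ∧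
    ∀ v, PartialMonitoring.DifferenceVectors L H v →
      ∃ κ₀ : ℝ, ∀ κ : ℝ, κ₀ ≤ κ → ∃ C : ℝ, ∀ T : ℕ, 1 ≤ T → ∀ η γ : ℝ,
        η = Real.sqrt (Real.log N / (24 * PartialMonitoring.vbar L v ^ 2 * T)) →
        γ = min (1 / 2) (κ / Real.sqrt T) →
        (∃ p, PartialMonitoring.StationaryRule L v η γ p) ∧
        ∀ p, PartialMonitoring.StationaryRule L v η γ p →
          ∀ opp : PartialMonitoring.Opponent N M A,
            (∀ φ ∈ PartialMonitoring.internalDepartures N,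
              PartialMonitoring.expectedRegret L H v η γ p opp T φ ≤ C * Real.sqrt T) ∧
            (∀ φ ∈ PartialMonitoring.externalDepartures N,
              PartialMonitoring.expectedRegret L H v η γ p opp T φ ≤ C * Real.sqrt T) := by
  open PartialMonitoring in
  refine ⟨hLH.exists_differenceVectors, fun v hv => ?_⟩
  obtain ⟨K, hK0, hK⟩ := hL.exists_expectedRegret_le (A := A)
  set lam := Real.sqrt (Real.log N / 24) with hlam
  have hV := vbar_nonneg L v
  set V := vbar L v with hVdef
  -- The first term gives ηv̄N/γ ≤ 1/2; the added 1 keeps κ positive when N = 1, where λ = 0.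
  refine ⟨2 * lam * N + 1, fun κ hκ => ?_⟩
  have hlam0 : 0 ≤ lam := Real.sqrt_nonneg _
  have hκ0 : 0 < κ := by
    have : 0 ≤ 2 * lam * N := by positivity
    linarith
  set k := V * lam * (8 + 4 * N) + 4 * κ * V with hk
  have hk0 : 0 ≤ k := by positivity
  set B := N * (12 * k + Real.log N * V / lam + V ^ 2 / (2 * k)) with hB
  have hB0 : 0 ≤ B := by
    have := Real.log_natCast_nonneg N
    positivity
  have hR := lossRange_nonneg L
  refine ⟨lossRange L * (2 * κ) + K * B, fun T hT η γ hη hγ => ?_⟩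
  have hT0 : (0 : ℝ) < T := by exact_mod_cast hT
  have hs : 0 < Real.sqrt T := Real.sqrt_pos.2 hT0
  have hγ0 : 0 < γ := by rw [hγ]; positivity
  have hγ2 : γ ≤ 1 / 2 := hγ.trans_le (min_le_left _ _)
  have hγ1 : γ ≤ 1 := by linarith
  refine ⟨exists_stationaryRule hN L v η hγ0.le hγ1, fun p hp opp => ?_⟩
  suffices h : ∀ φ, expectedRegret L H v η γ p opp T φ ≤
      (lossRange L * (2 * κ) + K * B) * Real.sqrt T from ⟨fun φ _ => h φ, fun φ _ => h φ⟩
  intro φ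
  have hA1 : 0 ≤ lossRange L * (2 * κ) * Real.sqrt T := by positivity
  have hA2 : 0 ≤ K * B * Real.sqrt T := by positivity
  rw [add_mul]
  -- If the minimum defining γ is attained only at 1/2, then √T < 2κ and the trivial bound, linear
  -- in T, is already of order √T.
  rcases le_or_gt (κ / Real.sqrt T) (1 / 2) with hbig | hsmall
  · have hnbr : ∀ i, ∀ j ∈ nbrs L i,
        expectedRegret L H v η γ p opp T (Function.update id i j) ≤ B * Real.sqrt T := by
      intro i j hj
      -- Equal rows give zero regret. This disposes of N = 1 and of v̄ = 0, where η = 0 and the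
      -- potential argument is unavailable.
      by_cases hdeg : L i = L j
      · rw [expectedRegret_update hp, hdeg, sub_self, zero_dotProduct]
        positivity
      · have hV0 : 0 < V := hV.lt_of_ne' fun h0 => hdeg (hv.eq_of_vbar_eq_zero h0 hj)
        have hN2 : 2 ≤ N := by
          by_contra hlt
          have : Subsingleton (Fin N) := Fin.subsingleton_iff_le_one.2 (by omega)
          exact hdeg (congrArg L (Subsingleton.elim i j))
        exact expectedRegret_update_le_sqrt hN2 hv hV0 hκ0 (by linarith) hT hη
          (by rw [hγ, min_eq_right hbig]) hγ2 hp hj hk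
    have := hK H v η γ hγ0.le hγ1 p hp opp T (B * Real.sqrt T) (by positivity) hnbr φ
    linarith
  · have h1 := expectedRegret_le_lossRange (H := H) (opp := opp) hγ0.le hγ1 hp T φ
    have h2 : Real.sqrt T ≤ 2 * κ := by
      rw [lt_div_iff₀ hs] at hsmall
      linarith
    have h3 : (T : ℝ) ≤ 2 * κ * Real.sqrt T := by
      calc (T : ℝ) = Real.sqrt T * Real.sqrt T := (Real.mul_self_sqrt hT0.le).symm
        _ ≤ _ := mul_le_mul_of_nonneg_right h2 hs.le
    have h4 := mul_le_mul_of_nonneg_left h3 hR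
    linarith
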